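/- \textbf{Setting.} For each $n\ge 1$ let $p=p_n\ge 3$, with $p_n\to\infty$ as $n\to\infty$. Let $G_\sigma=(\{1,\dots,p\},E_\sigma)$ be a $p$-cycle whose vertices are labelled by a reverse Cuthill–McKee (RCM) ordering $\sigma$, that is, $E_\sigma$ consists of the $p$ edges $(2,1)$, $(j,j-2)$ for $3\le j\le p$, and $(p,p-1)$. Let $E_\sigma^D\supseteq E_\sigma$ be the edge set of the filled graph, obtained from $E_\sigma$ by joining, for $k=1,2,\dots$ in turn, all neighbours $j>k$ of $k$ to each other. Let $\bar\Omega=\bar\Omega_n$ be a $p\times p$ positive definite matrix with $\bar\Omega_{ij}=0$ whenever $i\ne j$ and $(i,j)\notin E_\sigma$, and let $\bar L=\bar L_n$ be its Cholesky factor (lower triangular with positive diagonal entries, $\bar\Omega=\bar L\bar L^T$). Let $Y_{n,1},\dots,Y_{n,n}$ be i.i.d. random vectors in $\mathbb R^p$ with mean $0$ and covariance matrix $\bar\Omega^{-1}$, let $\bar P$ be the underlying probability measure, and let $S=\frac1n\sum_{i=1}^n Y_{n,i}Y_{n,i}^T$. \textbf{CCA estimators.} For $1\le j\le p$ let $N_j=\{k>j:(k,j)\in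 E_\sigma^D\}$, $S^{>j}=(S_{kl})_{k,l\in N_j}$, $S^>_{\cdot j}=(S_{kj})_{k\in N_j}$ and $s_j=S_{jj}-(S^>_{\cdot j})^T(S^{>j})^{-1}S^>_{\cdot j}$. Define the lower triangular matrix $\hat L^D$ by $\hat L^D_{jj}=s_j^{-1/2}$, $(\hat L^D_{kj})_{k\in N_j}=-s_j^{-1/2}(S^{>j})^{-1}S^>_{\cdot j}$, all other entries being $0$. The matrix $\hat L$ is obtained from $\hat L^D$ by going through the entries below the diagonal row by row, from left to right in each row, and setting $\hat L_{ij}=-\hat L_{jj}^{-1}\sum_{k<j}\hat L_{ik}\hat L_{jk}$ whenever $j<i$ and $(i,j)\notin E_\sigma$; the other entries are not changed. Put $\hat\Omega=\hat L\hat L^T$. (The estimators may be given arbitrary values where the inverses or square roots do not exist.) \textbf{Lemma.} Assume: (A1) there is $\delta>0$, not depending on $n$, such that all eigenvalues of $\bar\Omega_n$ lie in $[\delta,\delta^{-1}]$; (A2) there is $c>0$, not depending on $n$, such that $E[e^{x^TY_{n,i}}]\le e^{c\,x^Tx}$ for all $n$, all $1\le i\le n$ and all $x\in\mathbb R^{p_n}$;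 (A3$'$) there is $\xi<1$, not depending on $n$, such that $|\bar L_{j,j-2}|/\bar L_{jj}\le\xi$ for all $n$ and all $3\le j\le p_n-1$; and $|E_\sigma|\log p_n/n\to0$ as $n\to\infty$. Then there exist constants $\tilde K$ and $\tilde K'$, not depending on $n$, such that $$\bar P\left(\left\{\|\hat L-\bar L\|_F\le\tilde K\sqrt{\frac{(|E_\sigma|+1)\log p_n}{n}}\right\}\cap\left\{\|\hat\Omega-\bar\Omega\|_F\le\tilde K'\sqrt{\frac{(|E_\sigma|+1)\log p_n}{n}}\right\}\right)\longrightarrow1\quad\text{as }n\to\infty,$$ where $\|\cdot\|_F$ denotes the Frobenius norm. -/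

import Mathlib

open Filter Topology MeasureTheory ProbabilityTheory Matrix
open scoped Matrix.Norms.Frobenius

/-! ### Ordered graphs and the reverse Cuthill-McKee ordering

The vertices `1, …, p` of an ordered graph are the elements `0, …, p - 1` of `Fin p`. -/

/-- The ordered graph `G_σ`: the graph on the labels, `σ u` and `σ v` being adjacent if and only
if `u` and `v` are adjacent in `G`. -/
def orderedGraph {V : Type*} {p : ℕ} (G : SimpleGraph V) (σ : V ≃ Fin p) :
    SimpleGraph (Fin p) :=
  G.map σ.toEmbedding

/-- In an ordered graph, `w` is the parent of `v` if it is the first neighbour of `v` and comes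
before `v`. -/
def IsParent {p : ℕ} (G : SimpleGraph (Fin p)) (w v : Fin p) : Prop :=
  w < v ∧ G.Adj w v ∧ ∀ x, G.Adj x v → w ≤ x

/-- `τ` lists the vertices of the (connected) graph `G` in an order produced by the
Cuthill-McKee algorithm: list a starting vertex; then run through the list and append, for each
vertex in turn, those of its neighbours that are not yet listed, by increasing degree. Thus a
vertex is appended when its first neighbour in the list is processed. The choice of
the starting vertex and ties between degrees are left open. -/
structure IsCuthillMcKeeOrdering {V : Type*} {p : ℕ} (G : SimpleGraph V) (τ : V ≃ Fin p) :
    Prop where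
  exists_parent : ∀ v : Fin p, 0 < (v : ℕ) → ∃ w, IsParent (orderedGraph G τ) w v
  queue : ∀ u v wu wv : Fin p, u < v → IsParent (orderedGraph G τ) wu u →
    IsParent (orderedGraph G τ) wv v → wu ≤ wv
  degree : ∀ u v w : Fin p, u < v → IsParent (orderedGraph G τ) w u →
    IsParent (orderedGraph G τ) w v →
    ((orderedGraph G τ).neighborSet u).ncard ≤ ((orderedGraph G τ).neighborSet v).ncard

/-- `σ` is a reverse Cuthill-McKee (RCM) ordering of `G`: reversed, it is a Cuthill-McKee
ordering. -/
def IsRCMOrdering {V : Type*} {p : ℕ} (G : SimpleGraph V) (σ : V ≃ Fin p) : Prop :=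
  IsCuthillMcKeeOrdering G (σ.trans Fin.revPerm)

/-- The edges of the filled graph: starting with the edges of `G`, the later neighbours of each
vertex `k` are joined to each other. -/
inductive FillAdj {p : ℕ} (G : SimpleGraph (Fin p)) : Fin p → Fin p → Prop
  | base {i j : Fin p} : G.Adj i j → FillAdj G i j
  | fill {k i j : Fin p} : k < i → k < j → i ≠ j → FillAdj G i k → FillAdj G j k →
      FillAdj G i j

/-- The filled graph `G_σ^D` of an ordered graph `G_σ`. -/
def filledGraph {p : ℕ} (G : SimpleGraph (Fin p)) : SimpleGraph (Fin p) where
  Adj := FillAdj G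
  symm := ⟨by
    intro i j h
    cases h with
    | base h => exact FillAdj.base h.symm
    | fill hi hj hij h₁ h₂ => exact FillAdj.fill hj hi hij.symm h₂ h₁⟩
  loopless := ⟨by
    intro i h
    cases h with
    | base h => exact G.loopless.irrefl i h
    | fill hi hj hij h₁ h₂ => exact hij rfl⟩

/-! ### Concentration matrices and Cholesky factors -/

/-- The set `ℙ_{G_σ}` of positive definite matrices whose off-diagonal entries vanish outside the
edges of the ordered graph. -/
def concentrationSet {p : ℕ} (G : SimpleGraph (Fin p)) : Set (Matrix (Fin p) (Fin p) ℝ) :=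
  {A | A.PosDef ∧ ∀ i j, i ≠ j → ¬ G.Adj i j → A i j = 0}

/-- `L` is the Cholesky factor of `A`: it is lower triangular with positive diagonal entries, and
`A = L Lᵀ`. -/
structure IsCholeskyFactor {p : ℕ} (L A : Matrix (Fin p) (Fin p) ℝ) : Prop where
  lower : ∀ i j, i < j → L i j = 0
  diag_pos : ∀ i, 0 < L i i
  eq : A = L * Lᵀ

/-! ### The CCA estimators -/

/-- The sample covariance matrix `S = (1/n) ∑ᵢ Yᵢ Yᵢᵀ` of `n` observations with known
mean `0`. -/
noncomputable def sampleCov {n p : ℕ} (y : Fin n → Fin p → ℝ) : Matrix (Fin p) (Fin p) ℝ :=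
  fun a b => (∑ i, y i a * y i b) / n

/-- The index set `{k : k > j, (k,j) an edge}`. -/
abbrev LaterNbr {p : ℕ} (H : SimpleGraph (Fin p)) (j : Fin p) : Type :=
  {k : Fin p // j < k ∧ H.Adj k j}

/-- The vector `A^>_{·j}`. -/
def laterCol {p : ℕ} (H : SimpleGraph (Fin p)) (A : Matrix (Fin p) (Fin p) ℝ) (j : Fin p) :
    LaterNbr H j → ℝ :=
  fun k => A k j

/-- The matrix `A^{>j}`. -/
def laterBlock {p : ℕ} (H : SimpleGraph (Fin p)) (A : Matrix (Fin p) (Fin p) ℝ) (j : Fin p) :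
    Matrix (LaterNbr H j) (LaterNbr H j) ℝ :=
  fun k l => A k l

open Classical in
/-- The vector `(S^{>j})⁻¹ S^>_{·j}`. -/
noncomputable def regCoef {p : ℕ} (H : SimpleGraph (Fin p)) (S : Matrix (Fin p) (Fin p) ℝ)
    (j : Fin p) : LaterNbr H j → ℝ :=
  (laterBlock H S j)⁻¹ *ᵥ laterCol H S j

open Classical in
/-- The quantity `S_{jj} - (S^>_{·j})ᵀ (S^{>j})⁻¹ S^>_{·j}`. -/
noncomputable def residVar {p : ℕ} (H : SimpleGraph (Fin p)) (S : Matrix (Fin p) (Fin p) ℝ)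
    (j : Fin p) : ℝ :=
  S j j - laterCol H S j ⬝ᵥ regCoef H S j

open Classical in
/-- Step I of CCA: the Cholesky factor `L̂^D` of the Gaussian maximum likelihood estimator for the
decomposable ordered graph `H`, by its closed form. -/
noncomputable def stepOne {p : ℕ} (H : SimpleGraph (Fin p)) (S : Matrix (Fin p) (Fin p) ℝ) :
    Matrix (Fin p) (Fin p) ℝ :=
  fun i j =>
    if h : j < i ∧ H.Adj i j then -(regCoef H S j ⟨i, h⟩) / √(residVar H S j)
    else if i = j then 1 / √(residVar H S j)
    else 0

open Classical in
/-- Step II of CCA: row by row, and in each row from left to right, every entry `(i,j)` with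
`j < i` that is not an edge of `G_σ` is replaced by `-(∑_{k<j} L̂_{ik} L̂_{jk}) / L̂_{jj}`. The
entries on the right are those already updated. -/
noncomputable def stepTwo {p : ℕ} (G : SimpleGraph (Fin p)) (L : Matrix (Fin p) (Fin p) ℝ)
    (i j : Fin p) : ℝ :=
  if h : j < i ∧ ¬ G.Adj i j then
    -(∑ k : {k : Fin p // k < j}, stepTwo G L i k.1 * stepTwo G L j k.1) / stepTwo G L j j
  else L i j
termination_by ((i : ℕ), (j : ℕ))
decreasing_by
  · exact Prod.Lex.right _ k.2
  · exact Prod.Lex.left _ _ h.1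
  · exact Prod.Lex.left _ _ h.1

/-- The CCA estimator `L̂` for the ordered graph `G_σ`, from the sample covariance matrix. -/
noncomputable def ccaL {p : ℕ} (G : SimpleGraph (Fin p)) (S : Matrix (Fin p) (Fin p) ℝ) :
    Matrix (Fin p) (Fin p) ℝ :=
  Matrix.of (stepTwo G (stepOne (filledGraph G) S))

/-- The CCA estimator `Ω̂ = L̂ L̂ᵀ`. -/
noncomputable def ccaOmega {p : ℕ} (G : SimpleGraph (Fin p)) (S : Matrix (Fin p) (Fin p) ℝ) :
    Matrix (Fin p) (Fin p) ℝ :=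
  ccaL G S * (ccaL G S)ᵀ

/-! ### The data -/

/-- `Y₁, …, Yₙ` are i.i.d. random vectors with mean `0` and covariance matrix `Ω⁻¹`. -/
structure IsIIDSample {n p : ℕ} {X : Type*} [MeasurableSpace X] (P : Measure X)
    (Y : Fin n → X → Fin p → ℝ) (Ω : Matrix (Fin p) (Fin p) ℝ) : Prop where
  measurable : ∀ i, Measurable (Y i)
  indep : iIndepFun Y P
  ident : ∀ i j, IdentDistrib (Y i) (Y j) P P
  memLp : ∀ i a, MemLp (fun ω => Y i ω a) 2 P
  mean : ∀ i a, ∫ ω, Y i ω a ∂P = 0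
  cov : ∀ i a b, ∫ ω, Y i ω a * Y i ω b ∂P = (Ω⁻¹) a b

/-!
The neighbours of a vertex get close labels in a reverse Cuthill-McKee ordering: on a cycle, where
every degree is two, the labels of adjacent vertices differ by at most two, and the fill-in keeps
this bandwidth. Hence Step I consists of local regressions on at most two predictors, which are
Lipschitz in the entries of `S` near the true covariance matrix `Ω⁻¹`, and the regression
coefficients at `Ω⁻¹` are the entries of the true Cholesky factor `L`.

Both `L` and `L̂` satisfy the recursion of Step II, since `Ω` vanishes off the graph. With bandwidth
two only the entries on the first subdiagonal matter there; divided by the diagonal entry of its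
row, each is the previous one times `-L (j, j - 2) / L (j, j)`, of size at most `ξ < 1`. So the
errors do not accumulate, and `L̂ - L` is entrywise of the same order as `S - Ω⁻¹`, uniformly in
`p`.

Bernstein's inequality and a union bound over the `p ^ 2` entries give `S - Ω⁻¹` entrywise of order
`√(log p / n)`. A banded matrix has `O(p)` nonzero entries, so passing to the Frobenius norm costs a
factor `√p ≤ √(|E| + 1)`.
-/

/-! ### Reverse Cuthill-McKee orderings of the cycle -/

section Ordering

variable {V : Type*} {p : ℕ} {G : SimpleGraph V}

/-- The ordered graph `G` has bandwidth at most `w`: the labels of adjacent vertices differ by at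
most `w`. By symmetry of the adjacency it is enough to bound `i` in terms of `j`. -/
def HasBandwidthLE (G : SimpleGraph (Fin p)) (w : ℕ) : Prop :=
  ∀ i j, G.Adj i j → (i : ℕ) ≤ j + w

lemma orderedGraph_adj (σ : V ≃ Fin p) (i j : Fin p) :
    (orderedGraph G σ).Adj i j ↔ G.Adj (σ.symm i) (σ.symm j) := by
  conv_lhs => rw [← σ.apply_symm_apply i, ← σ.apply_symm_apply j]
  exact SimpleGraph.map_adj_apply

lemma orderedGraph_revPerm_adj (σ : V ≃ Fin p) (i j : Fin p) :
    (orderedGraph G (σ.trans Fin.revPerm)).Adj i.rev j.rev ↔ (orderedGraph G σ).Adj i j := by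
  simp [orderedGraph_adj]

lemma ncard_neighborSet_orderedGraph (σ : V ≃ Fin p) (i : Fin p) :
    ((orderedGraph G σ).neighborSet i).ncard = (G.neighborSet (σ.symm i)).ncard := by
  rw [← Set.ncard_image_of_injective _ σ.symm.injective]
  congr 1
  ext v
  simp [orderedGraph_adj]

lemma le_ncard_edgeSet_orderedGraph (hG : G.Connected) (σ : V ≃ Fin p) :
    p ≤ (orderedGraph G σ).edgeSet.ncard + 1 := by
  have hconn : (orderedGraph G σ).Connected := (SimpleGraph.Iso.map σ G).connected_iff.mp hG
  simpa using hconn.card_vert_le_card_edgeSet_add_one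

lemma ncard_neighborSet_cycleGraph_le (v : Fin p) :
    ((SimpleGraph.cycleGraph p).neighborSet v).ncard ≤ 2 := by
  match p with
  | 0 => exact v.elim0
  | 1 => exact (Set.ncard_le_card _).trans (by simp)
  | n + 2 =>
    rw [SimpleGraph.cycleGraph_neighborSet]
    exact (Set.ncard_insert_le _ _).trans (by simp)

lemma connected_cycleGraph (hp : 0 < p) : (SimpleGraph.cycleGraph p).Connected := by
  obtain ⟨n, rfl⟩ := Nat.exists_eq_add_one.mpr hp
  exact SimpleGraph.cycleGraph_connected

namespace IsCuthillMcKeeOrdering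

variable {τ : V ≃ Fin p}

lemma exists_adj_le_add_one (h : IsCuthillMcKeeOrdering G τ) {w : Fin p}
    (hw : (w : ℕ) + 1 < p) : ∃ x, (orderedGraph G τ).Adj w x ∧ (x : ℕ) ≤ w + 1 := by
  rcases Nat.eq_zero_or_pos (w : ℕ) with hw0 | hw0
  · obtain ⟨u, hu, hadj, -⟩ := h.exists_parent ⟨1, by omega⟩ one_pos
    have huw : u = w := Fin.ext (by simp only [Fin.lt_def] at hu; omega)
    exact ⟨_, huw ▸ hadj, by simp⟩
  · obtain ⟨u, hu, hadj, -⟩ := h.exists_parent w hw0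
    exact ⟨u, hadj.symm, by simp only [Fin.lt_def] at hu; omega⟩

-- If `v > w + 2`, then `w` is also the parent of `v - 1`, and has a third neighbour before that.
lemma le_parent_add_two (h : IsCuthillMcKeeOrdering G τ)
    (hdeg : ∀ v, (G.neighborSet v).ncard ≤ 2) {v w : Fin p}
    (hvw : IsParent (orderedGraph G τ) w v) : (v : ℕ) ≤ w + 2 := by
  induction hm : (v : ℕ) generalizing v w with
  | zero => omega
  | succ m ih =>
    by_contra! hlt
    obtain ⟨u, rfl⟩ : ∃ u : Fin p, (u : ℕ) = m := ⟨⟨m, by omega⟩, rfl⟩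
    have huv : u < v := by rw [Fin.lt_def]; omega
    obtain ⟨w₁, hw₁⟩ := h.exists_parent u (by omega)
    have hle : (u : ℕ) ≤ w₁ + 2 := ih hw₁ rfl
    have hqueue : (w₁ : ℕ) ≤ w := h.queue _ _ _ _ huv hw₁ hvw
    obtain rfl : w₁ = w := Fin.ext (by omega)
    obtain ⟨x, hx, hxw⟩ := h.exists_adj_le_add_one (w := w₁) (by omega)
    have hthree : 2 < ((orderedGraph G τ).neighborSet w₁).ncard :=
      (Set.two_lt_ncard_iff).mpr ⟨x, u, v, hx, hw₁.2.1, hvw.2.1, Fin.ne_of_val_ne (by omega),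
        Fin.ne_of_val_ne (by omega), huv.ne⟩
    rw [ncard_neighborSet_orderedGraph] at hthree
    exact (hdeg _).not_gt hthree

lemma hasBandwidthLE_two (h : IsCuthillMcKeeOrdering G τ)
    (hdeg : ∀ v, (G.neighborSet v).ncard ≤ 2) : HasBandwidthLE (orderedGraph G τ) 2 := by
  intro v w hvw
  rcases Nat.eq_zero_or_pos (v : ℕ) with hv | hv
  · omega
  · obtain ⟨u, hu⟩ := h.exists_parent v hv
    exact (h.le_parent_add_two hdeg hu).trans (Nat.add_le_add_right (hu.2.2 w hvw.symm) 2)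

end IsCuthillMcKeeOrdering

lemma IsRCMOrdering.hasBandwidthLE_two {σ : V ≃ Fin p} (h : IsRCMOrdering G σ)
    (hdeg : ∀ v, (G.neighborSet v).ncard ≤ 2) : HasBandwidthLE (orderedGraph G σ) 2 := by
  intro i j hij
  have hrev := IsCuthillMcKeeOrdering.hasBandwidthLE_two h hdeg j.rev i.rev
    ((orderedGraph_revPerm_adj σ j i).mpr hij.symm)
  simp only [Fin.val_rev] at hrev
  omega

end Ordering

/-! ### Fill-in and the zeros of a Cholesky factor -/

section Fill

variable {p : ℕ} {G : SimpleGraph (Fin p)} {F : Matrix (Fin p) (Fin p) ℝ} {w : ℕ}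

/-- `F` is lower triangular with at most `w` nonzero diagonals below the main one. -/
def IsLowerBanded (F : Matrix (Fin p) (Fin p) ℝ) (w : ℕ) : Prop :=
  ∀ i j, F i j ≠ 0 → j ≤ i ∧ (i : ℕ) ≤ j + w

/-- `F` satisfies the equations that Step II of CCA enforces. For a lower triangular `F` with
nonzero diagonal they say that `F Fᵀ` vanishes off the edges of `G`, so that they are shared by the
estimator and by the Cholesky factor of any matrix in `concentrationSet G`. -/
def CompletesZeros (G : SimpleGraph (Fin p)) (F : Matrix (Fin p) (Fin p) ℝ) : Prop :=
  ∀ i j, j < i → ¬ G.Adj i j → F i j = -(∑ k : {k : Fin p // k < j}, F i k * F j k) / F j j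

lemma FillAdj.hasBandwidthLE (hG : HasBandwidthLE G w) : HasBandwidthLE (filledGraph G) w := by
  have hboth {i j : Fin p} (h : FillAdj G i j) : (i : ℕ) ≤ j + w ∧ (j : ℕ) ≤ i + w := by
    induction h with
    | base h => exact ⟨hG _ _ h, hG _ _ h.symm⟩
    | fill hi hj _ _ _ ih₁ ih₂ =>
      rw [Fin.lt_def] at hi hj
      omega
  exact fun i j h => (hboth h).1

lemma sum_eq_sum_lt_add {f : Fin p → ℝ} {j : Fin p} (hf : ∀ k, j < k → f k = 0) :
    ∑ k, f k = ∑ k : {k : Fin p // k < j}, f k + f j := by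
  rw [← Finset.sum_subset (Finset.subset_univ (Finset.Iic j)) (by simpa using hf),
    ← Finset.Iio_insert, Finset.sum_insert (by simp), add_comm]
  congr 1
  exact Finset.sum_subtype _ (by simp) f

lemma IsCholeskyFactor.mul_apply {L A : Matrix (Fin p) (Fin p) ℝ} (hL : IsCholeskyFactor L A)
    (i j : Fin p) : A i j = ∑ k, L i k * L j k := by
  rw [hL.eq, Matrix.mul_apply]
  rfl

lemma IsCholeskyFactor.completesZeros {L A : Matrix (Fin p) (Fin p) ℝ}
    (hL : IsCholeskyFactor L A) (hA : A ∈ concentrationSet G) : CompletesZeros G L := by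
  intro i j hji hij
  have hsum := hL.mul_apply i j
  rw [sum_eq_sum_lt_add (fun k hk => by rw [hL.lower j k hk, mul_zero]),
    hA.2 i j hji.ne' hij] at hsum
  rw [eq_div_iff (hL.diag_pos j).ne']
  linarith

lemma completesZeros_stepTwo (L : Matrix (Fin p) (Fin p) ℝ) :
    CompletesZeros G (Matrix.of (stepTwo G L)) := by
  intro i j hji hij
  simp only [Matrix.of_apply]
  rw [stepTwo, dif_pos ⟨hji, hij⟩]

lemma CompletesZeros.eq_zero_of_not_fillAdj (hF : CompletesZeros G F) {i j : Fin p} (hji : j < i)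
    (hij : ¬ FillAdj G i j) : F i j = 0 := by
  induction j using WellFoundedLT.induction generalizing i with
  | _ j ih =>
    rw [hF i j hji fun h => hij (.base h), Finset.sum_eq_zero, neg_zero, zero_div]
    rintro ⟨k, hk⟩ -
    by_cases hik : FillAdj G i k
    · rw [ih k hk hk fun hjk => hij (.fill (hk.trans hji) hk hji.ne' hik hjk), mul_zero]
    · rw [ih k hk (hk.trans hji) hik, zero_mul]

lemma CompletesZeros.isLowerBanded (hF : CompletesZeros G F) (hlow : ∀ i j, i < j → F i j = 0)
    (hG : HasBandwidthLE G w) : IsLowerBanded F w := by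
  intro i j hne
  have hji : j ≤ i := not_lt.mp fun h => hne (hlow i j h)
  refine ⟨hji, ?_⟩
  rcases hji.eq_or_lt with rfl | hlt
  · omega
  · by_contra hw
    exact hne (hF.eq_zero_of_not_fillAdj hlt fun h => hw (FillAdj.hasBandwidthLE hG i j h))

lemma ccaL_apply_eq_zero (S : Matrix (Fin p) (Fin p) ℝ) {i j : Fin p} (hij : i < j) :
    ccaL G S i j = 0 := by
  rw [ccaL, Matrix.of_apply, stepTwo, dif_neg fun h => h.1.not_gt hij, stepOne,
    dif_neg fun h => h.1.not_gt hij, if_neg hij.ne]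

lemma completesZeros_ccaL (S : Matrix (Fin p) (Fin p) ℝ) : CompletesZeros G (ccaL G S) :=
  completesZeros_stepTwo _

lemma ccaL_apply_self (S : Matrix (Fin p) (Fin p) ℝ) (j : Fin p) :
    ccaL G S j j = stepOne (filledGraph G) S j j := by
  rw [ccaL, Matrix.of_apply, stepTwo, dif_neg fun h => h.1.ne rfl]

lemma ccaL_apply_of_adj (S : Matrix (Fin p) (Fin p) ℝ) {i j : Fin p} (hij : G.Adj i j) :
    ccaL G S i j = stepOne (filledGraph G) S i j := by
  rw [ccaL, Matrix.of_apply, stepTwo, dif_neg fun h => h.2 hij]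

end Fill

/-! ### Well-conditioned matrices and their Cholesky factors -/

section Spectrum

open scoped MatrixOrder

variable {N : Type*} [Fintype N] {A : Matrix N N ℝ} {δ r : ℝ}

/-- The quadratic form of `A`, which need not be symmetric, is bounded below by `δ` times the
squared Euclidean norm. -/
def CoerciveWith (δ : ℝ) (A : Matrix N N ℝ) : Prop :=
  ∀ x, δ * (x ⬝ᵥ x) ≤ x ⬝ᵥ A *ᵥ x

lemma abs_apply_le_of_posSemidef {N : Type*} [Finite N] {A : Matrix N N ℝ}
    (hA : A.PosSemidef) (hr : ∀ i, A i i ≤ r) (i j : N) : |A i j| ≤ r := by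
  classical
  cases nonempty_fintype N
  have hsymm : A j i = A i j := hA.isHermitian.apply i j
  have hform (s : ℝ) : 0 ≤ A i i + 2 * s * A i j + s ^ 2 * A j j := by
    have h := hA.dotProduct_mulVec_nonneg (Pi.single i 1 + s • Pi.single j 1)
    simp only [star_trivial, Matrix.mulVec_add, Matrix.mulVec_smul, Matrix.mulVec_single_one,
      add_dotProduct, smul_dotProduct, dotProduct_add, dotProduct_smul, single_one_dotProduct,
      Matrix.col_apply, hsymm, smul_eq_mul] at h
    linarith
  have hadd := hform 1
  have hsub := hform (-1)
  exact abs_le.mpr ⟨by linarith [hr i, hr j], by linarith [hr i, hr j]⟩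

variable [DecidableEq N]

lemma coerciveWith_of_spectrum (hA : A.IsHermitian) (h : ∀ t ∈ spectrum ℝ A, δ ≤ t) :
    CoerciveWith δ A := by
  intro x
  have hpsd : (A - algebraMap ℝ _ δ).PosSemidef :=
    Matrix.le_iff.mp ((algebraMap_le_iff_le_spectrum hA).mpr h)
  have hform := hpsd.dotProduct_mulVec_nonneg x
  simpa [Algebra.algebraMap_eq_smul_one, Matrix.sub_mulVec, Matrix.smul_mulVec] using hform

lemma apply_self_le_of_spectrum (hA : A.IsHermitian) (h : ∀ t ∈ spectrum ℝ A, t ≤ r) (i : N) :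
    A i i ≤ r := by
  have hpsd : (algebraMap ℝ _ r - A).PosSemidef :=
    Matrix.le_iff.mp ((le_algebraMap_iff_spectrum_le hA).mpr h)
  have hdiag := hpsd.diag_nonneg (i := i)
  simpa [Algebra.algebraMap_eq_smul_one] using hdiag

lemma spectrum_inv_subset_Icc (hA : IsUnit A) (hδ : 0 < δ)
    (h : spectrum ℝ A ⊆ Set.Icc δ δ⁻¹) : spectrum ℝ A⁻¹ ⊆ Set.Icc δ δ⁻¹ := by
  obtain ⟨u, rfl⟩ := hA
  rw [← Matrix.coe_units_inv, ← spectrum.map_inv]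
  intro t ht
  obtain ⟨hlo, hhi⟩ := h ht
  have ht : 0 < t := inv_pos.mp (hδ.trans_le hlo)
  exact ⟨(inv_le_inv₀ ht hδ).mp hhi, (le_inv_comm₀ hδ ht).mp hlo⟩

end Spectrum

namespace IsCholeskyFactor

variable {p : ℕ} {L A : Matrix (Fin p) (Fin p) ℝ} {r δ : ℝ}

lemma isUnit_det (hL : IsCholeskyFactor L A) : IsUnit L.det := by
  rw [Matrix.det_of_isLowerTriangular L fun i j h => hL.lower i j h]
  exact (Finset.prod_pos fun i _ => hL.diag_pos i).ne'.isUnit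

lemma inv_eq (hL : IsCholeskyFactor L A) : A⁻¹ = (L⁻¹)ᵀ * L⁻¹ := by
  rw [hL.eq, Matrix.mul_inv_rev, Matrix.transpose_nonsing_inv]

lemma transpose_mul_inv (hL : IsCholeskyFactor L A) : Lᵀ * A⁻¹ = L⁻¹ := by
  rw [hL.inv_eq, ← Matrix.mul_assoc, ← Matrix.transpose_mul,
    Matrix.nonsing_inv_mul _ hL.isUnit_det, Matrix.transpose_one, Matrix.one_mul]

lemma inv_apply_eq_zero (hL : IsCholeskyFactor L A) {i j : Fin p} (hij : i < j) :
    L⁻¹ i j = 0 := by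
  have hlow : L.BlockTriangular OrderDual.toDual := fun i j h => hL.lower i j h
  have := L.invertibleOfIsUnitDet hL.isUnit_det
  exact Matrix.blockTriangular_inv_of_blockTriangular hlow hij

lemma inv_apply_self (hL : IsCholeskyFactor L A) (j : Fin p) : L⁻¹ j j = (L j j)⁻¹ := by
  have hone : (L * L⁻¹) j j = 1 := by
    rw [Matrix.mul_nonsing_inv L hL.isUnit_det, Matrix.one_apply_eq]
  rw [Matrix.mul_apply, Finset.sum_eq_single_of_mem j (Finset.mem_univ j)] at hone
  · exact eq_inv_of_mul_eq_one_right hone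
  · intro k _ hk
    rcases hk.lt_or_gt with h | h
    · rw [hL.inv_apply_eq_zero h, mul_zero]
    · rw [hL.lower j k h, zero_mul]

lemma abs_apply_le_sqrt (hL : IsCholeskyFactor L A) (hr : ∀ i, A i i ≤ r) (i j : Fin p) :
    |L i j| ≤ √r := by
  refine Real.abs_le_sqrt (le_trans ?_ (hr i))
  rw [hL.mul_apply i i, sq]
  exact Finset.single_le_sum (f := fun k => L i k * L i k) (fun k _ => mul_self_nonneg _)
    (Finset.mem_univ j)

lemma sqrt_le_apply_self (hL : IsCholeskyFactor L A) (hδ : 0 < δ) {j : Fin p}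
    (h : A⁻¹ j j ≤ δ⁻¹) : √δ ≤ L j j := by
  have hLj := hL.diag_pos j
  have hle : (L j j)⁻¹ * (L j j)⁻¹ ≤ A⁻¹ j j := by
    rw [hL.inv_eq, Matrix.mul_apply, ← hL.inv_apply_self]
    exact Finset.single_le_sum (f := fun k => (L⁻¹)ᵀ j k * L⁻¹ k j)
      (fun k _ => mul_self_nonneg _) (Finset.mem_univ j)
  rw [Real.sqrt_le_left hLj.le, sq, ← inv_le_inv₀ (mul_pos hLj hLj) hδ, mul_inv]
  exact hle.trans h

end IsCholeskyFactor

/-! ### Perturbation of linear regressions -/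

section Perturbation

variable {N : Type*} {d : ℕ} {b δ ε η ρ : ℝ}

lemma abs_mul_sub_mul_le {x x' y y' a b c e : ℝ} (hx : |x| ≤ a) (hy : |y'| ≤ b)
    (hxx : |x - x'| ≤ c) (hyy : |y - y'| ≤ e) : |x * y - x' * y'| ≤ a * e + c * b := by
  have ha : 0 ≤ a := (abs_nonneg _).trans hx
  have hc : 0 ≤ c := (abs_nonneg _).trans hxx
  calc |x * y - x' * y'| = |x * (y - y') + (x - x') * y'| := by ring_nf
    _ ≤ |x| * |y - y'| + |x - x'| * |y'| := by
      rw [← abs_mul, ← abs_mul]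
      exact abs_add_le _ _
    _ ≤ a * e + c * b := by gcongr

variable [Fintype N]

lemma abs_sum_le_of_card_le {f : N → ℝ} {s : Finset N} (hs : s.card ≤ d) (hb : 0 ≤ b)
    (hzero : ∀ k, k ∉ s → f k = 0) (hf : ∀ k, |f k| ≤ b) : |∑ k, f k| ≤ d * b :=
  calc |∑ k, f k| = |∑ k ∈ s, f k| := by
        rw [Finset.sum_subset s.subset_univ fun k _ hk => hzero k hk]
    _ ≤ ∑ k ∈ s, |f k| := Finset.abs_sum_le_sum_abs _ _
    _ ≤ s.card • b := Finset.sum_le_card_nsmul _ _ _ fun k _ => hf k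
    _ ≤ d * b := by
        rw [nsmul_eq_mul]
        gcongr

lemma sq_sum_abs_le (hd : Fintype.card N ≤ d) (x : N → ℝ) :
    (∑ k, |x k|) ^ 2 ≤ d * (x ⬝ᵥ x) := by
  have hcs := sq_sum_le_card_mul_sum_sq (s := Finset.univ) (f := fun k => |x k|)
  have hxx : ∑ k, |x k| ^ 2 = x ⬝ᵥ x := by simp [dotProduct, sq]
  rw [hxx, Finset.card_univ] at hcs
  refine hcs.trans (mul_le_mul_of_nonneg_right ?_ (Finset.sum_nonneg fun k _ => mul_self_nonneg _))
  exact_mod_cast hd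

namespace CoerciveWith

variable {A B : Matrix N N ℝ}

lemma of_abs_sub_le (hA : CoerciveWith δ A) (hd : Fintype.card N ≤ d) (hε : 0 ≤ ε)
    (hAB : ∀ k l, |B k l - A k l| ≤ ε) : CoerciveWith (δ - d * ε) B := by
  intro x
  have hdiff : |x ⬝ᵥ (B - A) *ᵥ x| ≤ ε * (∑ k, |x k|) ^ 2 :=
    calc |x ⬝ᵥ (B - A) *ᵥ x| ≤ ∑ k, ∑ l, |x k| * (ε * |x l|) := by
          refine (Finset.abs_sum_le_sum_abs _ _).trans (Finset.sum_le_sum fun k _ => ?_)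
          rw [abs_mul, ← Finset.mul_sum]
          refine mul_le_mul_of_nonneg_left ?_ (abs_nonneg _)
          refine (Finset.abs_sum_le_sum_abs _ _).trans (Finset.sum_le_sum fun l _ => ?_)
          rw [abs_mul]
          exact mul_le_mul_of_nonneg_right (hAB k l) (abs_nonneg _)
      _ = ε * (∑ k, |x k|) ^ 2 := by
          simp_rw [← Finset.mul_sum, ← Finset.sum_mul]
          ring
  have hsq := mul_le_mul_of_nonneg_left (sq_sum_abs_le hd x) hε
  rw [Matrix.sub_mulVec, dotProduct_sub] at hdiff
  linarith [(abs_le.mp hdiff).1, hA x]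

lemma submatrix {M : Type*} [Fintype M] (hA : CoerciveWith δ A) {e : M → N}
    (he : Function.Injective e) : CoerciveWith δ (A.submatrix e e) := by
  classical
  intro x
  have hsum (f : N → ℝ) : Function.extend e x 0 ⬝ᵥ f = x ⬝ᵥ (f ∘ e) := by
    simp only [dotProduct]
    rw [← Finset.sum_subset (Finset.subset_univ (Finset.univ.map ⟨e, he⟩)), Finset.sum_map]
    · simp [he.extend_apply]
    · intro k _ hk
      rw [Function.extend_apply' _ _ _ fun ⟨m, hm⟩ => hk (by simp [← hm])]
      simp
  have hmul : (A *ᵥ Function.extend e x 0) ∘ e = A.submatrix e e *ᵥ x := by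
    ext m
    change A (e m) ⬝ᵥ _ = _
    rw [dotProduct_comm, hsum, dotProduct_comm]
    rfl
  have h := hA (Function.extend e x 0)
  rwa [hsum, hsum, hmul, Function.extend_comp he] at h

lemma abs_apply_le (hA : CoerciveWith δ A) (hδ : 0 < δ) (hd : Fintype.card N ≤ d) {x : N → ℝ}
    (hρ : ∀ k, |(A *ᵥ x) k| ≤ ρ) (k : N) : |x k| ≤ d * ρ / δ := by
  have hρ0 : 0 ≤ ρ := (abs_nonneg _).trans (hρ k)
  set s := ∑ k, |x k|
  have hks : |x k| ≤ s :=
    Finset.single_le_sum (f := fun k => |x k|) (fun _ _ => abs_nonneg _) (Finset.mem_univ k)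
  have hquad : δ * (x ⬝ᵥ x) ≤ s * ρ :=
    calc δ * (x ⬝ᵥ x) ≤ ∑ k, x k * (A *ᵥ x) k := hA x
      _ ≤ ∑ k, |x k| * ρ := Finset.sum_le_sum fun k _ => by
          refine (le_abs_self _).trans ?_
          rw [abs_mul]
          exact mul_le_mul_of_nonneg_left (hρ k) (abs_nonneg _)
      _ = s * ρ := (Finset.sum_mul _ _ _).symm
  rcases (abs_nonneg _ |>.trans hks).eq_or_lt with hs | hs
  · exact (hks.trans hs.symm.le).trans (by positivity)
  · refine hks.trans ?_
    rw [le_div_iff₀ hδ]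
    have hsq := mul_le_mul_of_nonneg_left (sq_sum_abs_le hd x) hδ.le
    have hdq := mul_le_mul_of_nonneg_left hquad d.cast_nonneg
    refine le_of_mul_le_mul_left ?_ hs
    calc s * (s * δ) = δ * s ^ 2 := by ring
      _ ≤ δ * (d * (x ⬝ᵥ x)) := hsq
      _ = d * (δ * (x ⬝ᵥ x)) := by ring
      _ ≤ d * (s * ρ) := hdq
      _ = s * (d * ρ) := by ring

variable [DecidableEq N]

lemma isUnit (hA : CoerciveWith δ A) (hδ : 0 < δ) : IsUnit A := by
  rw [← Matrix.mulVec_injective_iff_isUnit]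
  intro x y hxy
  have hzero (k : N) : (A *ᵥ (x - y)) k = 0 := by simp [Matrix.mulVec_sub, hxy]
  ext k
  have hk := hA.abs_apply_le hδ le_rfl (fun k => (abs_eq_zero.mpr (hzero k)).le) k
  rw [mul_zero, zero_div, abs_nonpos_iff] at hk
  exact sub_eq_zero.mp hk

lemma mulVec_inv_mulVec (hA : CoerciveWith δ A) (hδ : 0 < δ) (v : N → ℝ) :
    A *ᵥ (A⁻¹ *ᵥ v) = v := by
  rw [Matrix.mulVec_mulVec, Matrix.mul_nonsing_inv _ ((A.isUnit_iff_isUnit_det).mp (hA.isUnit hδ)),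
    Matrix.one_mulVec]

lemma abs_inv_mulVec_le (hA : CoerciveWith δ A) (hδ : 0 < δ) (hd : Fintype.card N ≤ d)
    {v : N → ℝ} (hv : ∀ k, |v k| ≤ ρ) (k : N) : |(A⁻¹ *ᵥ v) k| ≤ d * ρ / δ :=
  hA.abs_apply_le hδ hd (by rwa [hA.mulVec_inv_mulVec hδ]) k

lemma abs_inv_mulVec_sub_le (hA : CoerciveWith δ A) (hδ : 0 < δ) (hB : CoerciveWith η B)
    (hη : 0 < η) (hd : Fintype.card N ≤ d) (hAB : ∀ k l, |B k l - A k l| ≤ ε) {u v : N → ℝ}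
    (hu : ∀ k, |u k| ≤ ρ) (huv : ∀ k, |v k - u k| ≤ ε) (k : N) :
    |(B⁻¹ *ᵥ v) k - (A⁻¹ *ᵥ u) k| ≤ d * (ε + d * (ε * (d * ρ / δ))) / η := by
  have hε : 0 ≤ ε := (abs_nonneg _).trans (huv k)
  have hρ : 0 ≤ ρ := (abs_nonneg _).trans (hu k)
  refine hB.abs_apply_le hη hd (x := B⁻¹ *ᵥ v - A⁻¹ *ᵥ u) (fun k => ?_) k
  have hresidual : B *ᵥ (B⁻¹ *ᵥ v - A⁻¹ *ᵥ u) = (v - u) - (B - A) *ᵥ (A⁻¹ *ᵥ u) := by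
    rw [Matrix.mulVec_sub, hB.mulVec_inv_mulVec hη, Matrix.sub_mulVec, hA.mulVec_inv_mulVec hδ]
    abel
  rw [hresidual]
  refine (abs_sub _ _).trans (add_le_add (huv k) ?_)
  refine abs_sum_le_of_card_le (s := Finset.univ) hd (by positivity) (by simp) fun l => ?_
  rw [abs_mul]
  exact mul_le_mul (hAB k l) (hA.abs_inv_mulVec_le hδ hd hu l) (abs_nonneg _) hε

end CoerciveWith

lemma one_div_sqrt_le {a : ℝ} (hη : 0 < η) (ha : η ≤ a) : 1 / √a ≤ 1 / √η :=
  one_div_le_one_div_of_le (Real.sqrt_pos.mpr hη) (Real.sqrt_le_sqrt ha)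

lemma abs_one_div_sqrt_sub_le {a b : ℝ} (hη : 0 < η) (ha : η ≤ a) (hb : η ≤ b) :
    |1 / √a - 1 / √b| ≤ (1 / √η) ^ 3 * |a - b| := by
  have ha' : 0 < √a := Real.sqrt_pos.mpr (hη.trans_le ha)
  have hb' : 0 < √b := Real.sqrt_pos.mpr (hη.trans_le hb)
  have hfactor : 1 / √a - 1 / √b = -(1 / √a * (1 / √b) * (1 / (√a + √b))) * (a - b) := by
    have hsq : a - b = √a ^ 2 - √b ^ 2 := by
      rw [Real.sq_sqrt (hη.le.trans ha), Real.sq_sqrt (hη.le.trans hb)]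
    rw [hsq]
    field_simp
    ring
  have hsum : 1 / (√a + √b) ≤ 1 / √η :=
    (one_div_le_one_div_of_le ha' (by linarith)).trans (one_div_sqrt_le hη ha)
  rw [hfactor, abs_mul, abs_neg, abs_of_pos (by positivity)]
  calc _ ≤ 1 / √η * (1 / √η) * (1 / √η) * |a - b| := by gcongr
    _ = _ := by ring

end Perturbation

/-! ### Step I -/

section StepOne

variable {p w : ℕ} {H : SimpleGraph (Fin p)} {L Ω S A : Matrix (Fin p) (Fin p) ℝ}

lemma card_le_of_forall_lt_add {s : Finset (Fin p)} {a d : ℕ}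
    (h : ∀ k ∈ s, a ≤ (k : ℕ) ∧ (k : ℕ) < a + d) : s.card ≤ d := by
  have hmaps : Set.MapsTo Fin.val (s : Set (Fin p)) (Finset.Ico a (a + d)) :=
    fun k hk => by simpa using h k hk
  simpa using Finset.card_le_card_of_injOn _ hmaps Fin.val_injective.injOn

open Classical in
lemma card_laterNbr_le (hH : HasBandwidthLE H w) (j : Fin p) :
    Fintype.card (LaterNbr H j) ≤ w := by
  rw [Fintype.card_subtype]
  refine card_le_of_forall_lt_add (a := j + 1) fun k hk => ?_
  obtain ⟨hjk, hadj⟩ := (Finset.mem_filter.mp hk).2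
  have := hH k j hadj
  rw [Fin.lt_def] at hjk
  omega

open Classical in
lemma sum_eq_add_sum_laterNbr {j : Fin p} {f : Fin p → ℝ}
    (hf : ∀ k, k ≠ j → ¬ (j < k ∧ H.Adj k j) → f k = 0) :
    ∑ k, f k = f j + ∑ k : LaterNbr H j, f k := by
  rw [← Finset.sum_subtype {k | j < k ∧ H.Adj k j} (by simp) f, ← Finset.sum_insert (by simp)]
  refine (Finset.sum_subset (Finset.subset_univ _) fun k _ hk => ?_).symm
  simp only [Finset.mem_insert, Finset.mem_filter, Finset.mem_univ, true_and, not_or] at hk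
  exact hf k hk.1 hk.2

open Classical in
-- This is `Lᵀ Ω⁻¹ = L⁻¹`, read off in row `j`: the normal equations of the regression of the
-- `j`-th coordinate on its later neighbours.
lemma IsCholeskyFactor.inv_apply_eq_add_sum (hL : IsCholeskyFactor L Ω)
    (hLH : ∀ i j, j < i → ¬ H.Adj i j → L i j = 0) (j m : Fin p) :
    L⁻¹ j m = L j j * Ω⁻¹ j m + ∑ k : LaterNbr H j, L k j * Ω⁻¹ k m := by
  rw [← hL.transpose_mul_inv, Matrix.mul_apply]
  refine sum_eq_add_sum_laterNbr (f := fun k => Lᵀ j k * Ω⁻¹ k m) fun k hkj hk => ?_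
  suffices L k j = 0 by rw [Matrix.transpose_apply, this, zero_mul]
  rcases hkj.lt_or_gt with h | h
  · exact hL.lower k j h
  · exact hLH k j h fun hadj => hk ⟨h, hadj⟩

section Population

variable (hL : IsCholeskyFactor L Ω) (hΩ : Ω.PosDef)
  (hLH : ∀ i j, j < i → ¬ H.Adj i j → L i j = 0)

include hL hΩ hLH

lemma regCoef_inv (j : Fin p) (k : LaterNbr H j) : regCoef H Ω⁻¹ j k = -(L k j / L j j) := by
  classical
  have hsymm (a b : Fin p) : Ω⁻¹ a b = Ω⁻¹ b a := hΩ.inv.isHermitian.apply b a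
  have hunit : IsUnit (laterBlock H Ω⁻¹ j) :=
    (hΩ.inv.submatrix (Subtype.val_injective (p := fun k => j < k ∧ H.Adj k j))).isUnit
  have hnormal : laterBlock H Ω⁻¹ j *ᵥ (fun k => -(L k j / L j j)) = laterCol H Ω⁻¹ j := by
    ext m
    have hrow := hL.inv_apply_eq_add_sum hLH j m
    rw [hL.inv_apply_eq_zero m.2.1] at hrow
    have hsum : (laterBlock H Ω⁻¹ j *ᵥ fun k => -(L k j / L j j)) m
        = -(∑ k : LaterNbr H j, L k j * Ω⁻¹ k m) / L j j := by
      rw [Matrix.mulVec, dotProduct, neg_div, Finset.sum_div, ← Finset.sum_neg_distrib]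
      refine Finset.sum_congr rfl fun k _ => ?_
      rw [laterBlock, hsymm m k]
      ring
    rw [hsum, laterCol, hsymm m j, div_eq_iff (hL.diag_pos j).ne']
    linarith
  rw [regCoef, ← hnormal, Matrix.mulVec_mulVec,
    Matrix.nonsing_inv_mul _ ((Matrix.isUnit_iff_isUnit_det _).mp hunit), Matrix.one_mulVec]

lemma residVar_inv (j : Fin p) : residVar H Ω⁻¹ j = (L j j ^ 2)⁻¹ := by
  classical
  have hrow := hL.inv_apply_eq_add_sum hLH j j
  rw [hL.inv_apply_self] at hrow
  have hsum : laterCol H Ω⁻¹ j ⬝ᵥ regCoef H Ω⁻¹ j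
      = -(∑ k : LaterNbr H j, L k j * Ω⁻¹ k j) / L j j := by
    rw [dotProduct, neg_div, Finset.sum_div, ← Finset.sum_neg_distrib]
    refine Finset.sum_congr rfl fun k _ => ?_
    rw [regCoef_inv hL hΩ hLH, laterCol]
    ring
  have hLj := (hL.diag_pos j).ne'
  rw [residVar, hsum, sq, mul_inv, eq_mul_inv_iff_mul_eq₀ hLj, hrow]
  field_simp
  ring

lemma stepOne_inv : stepOne H Ω⁻¹ = L := by
  ext i j
  have hLj := hL.diag_pos j
  have hsqrt : √(residVar H Ω⁻¹ j) = (L j j)⁻¹ := by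
    rw [residVar_inv hL hΩ hLH, Real.sqrt_inv, Real.sqrt_sq hLj.le]
  unfold stepOne
  split_ifs with hij hdiag
  · rw [hsqrt, regCoef_inv hL hΩ hLH]
    field_simp
  · rw [hsqrt, hdiag, one_div, inv_inv]
  · rcases Ne.lt_or_gt hdiag with h | h
    · exact (hL.lower i j h).symm
    · exact (hLH i j h fun hadj => hij ⟨h, hadj⟩).symm

end Population

variable {δ M ε : ℝ}

open Classical in
lemma CoerciveWith.laterBlock (hA : CoerciveWith δ A) (j : Fin p) :
    CoerciveWith δ (laterBlock H A j) :=
  hA.submatrix Subtype.val_injective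

lemma abs_regCoef_le (hH : HasBandwidthLE H w) (hδ : 0 < δ) (hA : CoerciveWith δ A)
    (hM : ∀ i j, |A i j| ≤ M) (j : Fin p) (k : LaterNbr H j) :
    |regCoef H A j k| ≤ w * M / δ := by
  classical
  exact (hA.laterBlock j).abs_inv_mulVec_le hδ (card_laterNbr_le hH j) (fun m => hM m j) k

lemma abs_regCoef_sub_le (hH : HasBandwidthLE H w) (hδ : 0 < δ) (hA : CoerciveWith δ A)
    (hM : ∀ i j, |A i j| ≤ M) (hε : 0 ≤ ε) (hwε : w * ε ≤ δ / 2)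
    (hS : ∀ i j, |S i j - A i j| ≤ ε) (j : Fin p) (k : LaterNbr H j) :
    |regCoef H S j k - regCoef H A j k| ≤ w * (1 + w * (w * M / δ)) / (δ / 2) * ε := by
  classical
  have hcard := card_laterNbr_le hH j
  have hSj : CoerciveWith (δ - w * ε) (laterBlock H S j) :=
    (hA.laterBlock j).of_abs_sub_le hcard hε fun k l => hS k l
  have hSj : CoerciveWith (δ / 2) (laterBlock H S j) := fun x =>
    (mul_le_mul_of_nonneg_right (by linarith)
      (Finset.sum_nonneg fun k _ => mul_self_nonneg (x k))).trans (hSj x)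
  refine ((hA.laterBlock j).abs_inv_mulVec_sub_le hδ hSj (half_pos hδ) hcard
    (fun k l => hS k l) (fun m => hM m j) (fun m => hS m j) k).trans_eq ?_
  ring

lemma abs_residVar_sub_le {B C : ℝ} (hH : HasBandwidthLE H w) (hM : ∀ i j, |A i j| ≤ M)
    (hε : 0 ≤ ε) (hε1 : ε ≤ 1) (hS : ∀ i j, |S i j - A i j| ≤ ε) (hB : 0 ≤ B) (hC : 0 ≤ C)
    {j : Fin p} (hreg : ∀ k, |regCoef H A j k| ≤ B)
    (hsub : ∀ k, |regCoef H S j k - regCoef H A j k| ≤ C * ε) :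
    |residVar H S j - residVar H A j| ≤ (1 + w * ((M + 1) * C + B)) * ε := by
  classical
  have hM0 : 0 ≤ M := (abs_nonneg _).trans (hM j j)
  have hterm (k : LaterNbr H j) :
      |S k j * regCoef H S j k - A k j * regCoef H A j k| ≤ ((M + 1) * C + B) * ε := by
    have hSk : |S k j| ≤ M + 1 := by
      have := abs_add_le (S k j - A k j) (A k j)
      rw [sub_add_cancel] at this
      linarith [hS k j, hM k j]
    refine (abs_mul_sub_mul_le hSk (hreg k) (hS k j) (hsub k)).trans_eq ?_
    ring
  have hsum := abs_sum_le_of_card_le (s := Finset.univ) (card_laterNbr_le hH j)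
    (by positivity) (by simp) hterm
  have hsplit : residVar H S j - residVar H A j = (S j j - A j j)
      - ∑ k : LaterNbr H j, (S k j * regCoef H S j k - A k j * regCoef H A j k) := by
    rw [Finset.sum_sub_distrib]
    simp only [residVar, dotProduct, laterCol]
    ring
  rw [hsplit]
  refine (abs_sub _ _).trans ?_
  linarith [hS j j]

lemma abs_stepOne_sub_le {B C D η : ℝ} (hη : 0 < η) (hε : 0 ≤ ε) (hB : 0 ≤ B) (hC : 0 ≤ C)
    (hD : 0 ≤ D) (i : Fin p) {j : Fin p} (hA : η ≤ residVar H A j) (hS : η ≤ residVar H S j)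
    (hresid : |residVar H S j - residVar H A j| ≤ D * ε)
    (hreg : ∀ k, |regCoef H A j k| ≤ B)
    (hsub : ∀ k, |regCoef H S j k - regCoef H A j k| ≤ C * ε) :
    |stepOne H S i j - stepOne H A i j|
      ≤ (1 / √η * C + (1 / √η) ^ 3 * D * B + (1 / √η) ^ 3 * D) * ε := by
  set R := 1 / √η
  have : 0 ≤ R := by positivity
  have hsqrt : |1 / √(residVar H S j) - 1 / √(residVar H A j)| ≤ R ^ 3 * (D * ε) :=
    (abs_one_div_sqrt_sub_le hη hS hA).trans (by gcongr)
  have hle : |1 / √(residVar H S j)| ≤ R := by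
    rw [abs_of_nonneg (by positivity)]
    exact one_div_sqrt_le hη hS
  have hRC : 0 ≤ R * C * ε := by positivity
  have hRDB : 0 ≤ R ^ 3 * D * B * ε := by positivity
  have hRD : 0 ≤ R ^ 3 * D * ε := by positivity
  unfold stepOne
  split_ifs with hij hdiag
  · have h := abs_mul_sub_mul_le hle (hreg ⟨i, hij⟩) hsqrt (hsub ⟨i, hij⟩)
    rw [← abs_neg] at h
    have hcomm : -regCoef H S j ⟨i, hij⟩ / √(residVar H S j)
        - -regCoef H A j ⟨i, hij⟩ / √(residVar H A j)
        = -(1 / √(residVar H S j) * regCoef H S j ⟨i, hij⟩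
          - 1 / √(residVar H A j) * regCoef H A j ⟨i, hij⟩) := by ring
    rw [hcomm]
    linarith
  · linarith
  · rw [sub_zero, abs_zero]
    linarith

lemma exists_abs_stepOne_sub_le (w : ℕ) (hδ : 0 < δ) (hM : 0 ≤ M) : ∃ C ε₀ : ℝ, 0 < C ∧ 0 < ε₀ ∧
    ∀ (p : ℕ) (H : SimpleGraph (Fin p)) (A S : Matrix (Fin p) (Fin p) ℝ) (ε : ℝ),
      HasBandwidthLE H w → CoerciveWith δ A → (∀ i j, |A i j| ≤ M) →
      (∀ j, δ ≤ residVar H A j) → 0 ≤ ε → ε ≤ ε₀ → (∀ i j, |S i j - A i j| ≤ ε) →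
      ∀ i j, |stepOne H S i j - stepOne H A i j| ≤ C * ε := by
  set B := w * M / δ
  set C := w * (1 + w * (w * M / δ)) / (δ / 2)
  set D := 1 + w * ((M + 1) * C + B)
  have hB : 0 ≤ B := by positivity
  have hC : 0 ≤ C := by positivity
  have hD : 0 < D := by positivity
  refine ⟨1 / √(δ / 2) * C + (1 / √(δ / 2)) ^ 3 * D * B + (1 / √(δ / 2)) ^ 3 * D,
    min 1 (min (δ / 2 / (w + 1)) (δ / 2 / D)), by positivity, by positivity, ?_⟩
  intro p H A S ε hH hA hAM hAj hε hε₀ hS i j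
  simp only [le_min_iff] at hε₀
  obtain ⟨hε1, hεw, hεD⟩ := hε₀
  rw [le_div_iff₀ (by positivity)] at hεw hεD
  have hreg := abs_regCoef_le hH hδ hA hAM j
  have hsub := abs_regCoef_sub_le hH hδ hA hAM hε (by linarith) hS j
  have hresid := abs_residVar_sub_le hH hAM hε hε1 hS hB hC hreg hsub
  have hSj : δ / 2 ≤ residVar H S j := by linarith [(abs_le.mp hresid).1, hAj j]
  exact abs_stepOne_sub_le (half_pos hδ) hε hB hC hD.le i (by linarith [hAj j]) hSj hresid hreg hsub

end StepOne

/-! ### Step II -/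

section StepTwo

variable {p : ℕ} {G : SimpleGraph (Fin p)} {F L Ω : Matrix (Fin p) (Fin p) ℝ}

lemma IsLowerBanded.eq_zero {w : ℕ} (hF : IsLowerBanded F w) {i j : Fin p}
    (h : i < j ∨ (j : ℕ) + w < i) : F i j = 0 := by
  by_contra hne
  have hij := hF i j hne
  rw [Fin.le_def] at hij
  rw [Fin.lt_def] at h
  omega

lemma CompletesZeros.apply_eq_zero {w : ℕ} (hF : CompletesZeros G F) (hFb : IsLowerBanded F w)
    {i j : Fin p} (hji : j < i) (hij : ¬ G.Adj i j) (h : (j : ℕ) + w = i ∨ (j : ℕ) = 0) :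
    F i j = 0 := by
  rw [hF i j hji hij, Finset.sum_eq_zero, neg_zero, zero_div]
  rintro ⟨k, hk⟩ -
  rw [Fin.lt_def] at hk
  have hik : F i k = 0 := hFb.eq_zero (.inr (by omega))
  simp only [hik, zero_mul]

lemma CompletesZeros.apply_subdiagonal (hF : CompletesZeros G F) (hFb : IsLowerBanded F 2)
    {i j k : Fin p} (hkj : (k : ℕ) + 1 = j) (hji : (j : ℕ) + 1 = i) (hij : ¬ G.Adj i j) :
    F i j = -(F i k / F j j * F j k) := by
  rw [hF i j (by rw [Fin.lt_def]; omega) hij,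
    Finset.sum_eq_single ⟨k, by rw [Fin.lt_def]; omega⟩ _ (by simp)]
  · ring
  · rintro ⟨l, hl⟩ - hne
    rw [Fin.lt_def] at hl
    have hlk : (l : ℕ) ≠ k := fun h => hne (Subtype.ext (Fin.ext h))
    have hil : F i l = 0 := hFb.eq_zero (.inr (by omega))
    simp only [hil, zero_mul]

lemma abs_div_sub_div_le {x x' y y' b η μ : ℝ} (hμ : 0 < μ) (hημ : η ≤ μ / 2) (hx : |x'| ≤ b)
    (hy : μ ≤ y') (hxx : |x - x'| ≤ η) (hyy : |y - y'| ≤ η) :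
    |x / y - x' / y'| ≤ (2 / μ + 2 * b / μ ^ 2) * η := by
  have : 0 ≤ b := (abs_nonneg _).trans hx
  have : 0 ≤ η := (abs_nonneg _).trans hxx
  have hy0 : 0 < y' := hμ.trans_le hy
  have hyμ : μ / 2 ≤ y := by linarith [(abs_le.mp hyy).1]
  have : 0 < y := (half_pos hμ).trans_le hyμ
  have hsplit : x / y - x' / y' = (x - x') / y - x' * (y - y') / (y * y') := by
    field_simp
    ring
  calc |x / y - x' / y'| ≤ |x - x'| / y + |x'| * |y - y'| / (y * y') := by
        rw [hsplit]
        refine (abs_sub _ _).trans_eq ?_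
        rw [abs_div, abs_div, abs_mul, abs_of_pos ‹0 < y›, abs_of_pos (by positivity : 0 < y * y')]
    _ ≤ η / (μ / 2) + b * η / (μ / 2 * μ) := by gcongr
    _ = (2 / μ + 2 * b / μ ^ 2) * η := by
        field_simp

section Propagation

variable {η : ℝ} (hF : CompletesZeros G F) (hL : CompletesZeros G L) (hFb : IsLowerBanded F 2)
  (hLb : IsLowerBanded L 2) (hdiag : ∀ i, |F i i - L i i| ≤ η)
  (hadj : ∀ i j, G.Adj i j → |F i j - L i j| ≤ η)

include hF hL hFb hLb hdiag hadj

lemma abs_sub_le_of_subdiagonal_imp {i j : Fin p}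
    (h : (j : ℕ) + 1 = i → (j : ℕ) = 0 ∨ G.Adj i j) : |F i j - L i j| ≤ η := by
  by_cases hij : G.Adj i j
  · exact hadj i j hij
  have hη : 0 ≤ η := (abs_nonneg _).trans (hdiag i)
  suffices i = j ∨ F i j = 0 ∧ L i j = 0 by
    rcases this with rfl | ⟨hFij, hLij⟩
    · exact hdiag i
    · rwa [hFij, hLij, sub_zero, abs_zero]
  rcases lt_trichotomy i j with hlt | heq | hgt
  · exact .inr ⟨hFb.eq_zero (.inl hlt), hLb.eq_zero (.inl hlt)⟩
  · exact .inl heq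
  · have := Fin.lt_def.mp hgt
    right
    by_cases hfar : (j : ℕ) + 2 < i
    · exact ⟨hFb.eq_zero (.inr hfar), hLb.eq_zero (.inr hfar)⟩
    · have hedge : (j : ℕ) + 2 = i ∨ (j : ℕ) = 0 := by
        by_cases hsub : (j : ℕ) + 1 = i
        · exact .inr ((h hsub).resolve_right hij)
        · omega
      exact ⟨hF.apply_eq_zero hFb hgt hij hedge, hL.apply_eq_zero hLb hgt hij hedge⟩

variable {b ξ κ μ D : ℝ} (hμ : 0 < μ) (hημ : η ≤ μ / 2) (hLμ : ∀ i, μ ≤ L i i)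
  (hLb' : ∀ i j, |L i j| ≤ b) (hD : D = 2 / μ + 2 * b / μ ^ 2)

include hμ hημ hLμ hLb' hD

lemma abs_sub_le_of_subdiagonal {i j k : Fin p} (hκη : κ * η ≤ 1) (hkj : (k : ℕ) + 1 = j)
    (hji : (j : ℕ) + 1 = i) (hij : ¬ G.Adj i j) (hjk : |F j k - L j k| ≤ κ * η * L j j) :
    |F i j - L i j| ≤ (|L i k| * κ + 2 * D * b) * η := by
  have : 0 ≤ b := (abs_nonneg _).trans (hLb' j j)
  have : 0 ≤ η := (abs_nonneg _).trans (hdiag j)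
  have hLj : 0 < L j j := hμ.trans_le (hLμ j)
  have hik : |F i k - L i k| ≤ η :=
    abs_sub_le_of_subdiagonal_imp hF hL hFb hLb hdiag hadj fun h => by omega
  have hquot : |F i k / F j j - L i k / L j j| ≤ D * η :=
    hD ▸ abs_div_sub_div_le hμ hημ (hLb' i k) (hLμ j) hik (hdiag j)
  have hquot_le : |F i k / F j j| ≤ |L i k| / L j j + D * η := by
    have habs : |L i k / L j j| = |L i k| / L j j := by rw [abs_div, abs_of_pos hLj]
    linarith [abs_sub_abs_le_abs_sub (F i k / F j j) (L i k / L j j)]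
  have : 0 ≤ D := by rw [hD]; positivity
  rw [hF.apply_subdiagonal hFb hkj hji hij, hL.apply_subdiagonal hLb hkj hji hij, neg_sub_neg,
    abs_sub_comm]
  calc _ ≤ (|L i k| / L j j + D * η) * (κ * η * L j j) + D * η * b :=
        abs_mul_sub_mul_le hquot_le (hLb' j k) hquot hjk
    _ = |L i k| * κ * η + D * η * (κ * η) * L j j + D * η * b := by field_simp
    _ ≤ |L i k| * κ * η + D * η * 1 * b + D * η * b := by
        gcongr
        exact (le_abs_self _).trans (hLb' j j)
    _ = (|L i k| * κ + 2 * D * b) * η := by ring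

variable (hκ : 0 ≤ κ) (hκη : κ * η ≤ 1) (hκμ : 1 ≤ κ * μ)

include hκ hκη hκμ

-- The error relative to the diagonal entry of its row contracts by the factor `ξ` from one row to
-- the next, up to a term of order `η`; the constant `κ` is a fixed point of this recursion.
lemma abs_sub_le_mul_diagonal (hκξ : 2 * D * b ≤ (1 - ξ) * (κ * μ))
    (hratio : ∀ i j : Fin p, (i : ℕ) + 2 = j → (j : ℕ) + 1 < p → |L j i| / L j j ≤ ξ) (m : ℕ) :
    ∀ i j : Fin p, (j : ℕ) = m → (j : ℕ) + 1 = i → (i : ℕ) + 1 < p →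
      |F i j - L i j| ≤ κ * η * L i i := by
  have hbase (i : Fin p) : η ≤ κ * η * L i i := by
    have : 0 ≤ η := (abs_nonneg _).trans (hdiag i)
    calc η = 1 * η := (one_mul η).symm
      _ ≤ κ * L i i * η := by
        gcongr
        exact hκμ.trans (by gcongr; exact hLμ i)
      _ = κ * η * L i i := by ring
  induction m with
  | zero =>
    exact fun i j hj _ _ => (abs_sub_le_of_subdiagonal_imp hF hL hFb hLb hdiag hadj
      fun _ => .inl hj).trans (hbase i)
  | succ m ih =>
    intro i j hj hji hip
    by_cases hij : G.Adj i j
    · exact (hadj i j hij).trans (hbase i)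
    obtain ⟨k, hk⟩ : ∃ k : Fin p, (k : ℕ) = m := ⟨⟨m, by omega⟩, rfl⟩
    have hLi : 0 < L i i := hμ.trans_le (hLμ i)
    have : 0 ≤ η := (abs_nonneg _).trans (hdiag i)
    have hLik : |L i k| ≤ ξ * L i i := (div_le_iff₀ hLi).mp (hratio k i (by omega) hip)
    have hξ : 0 ≤ 1 - ξ := by
      by_contra hneg
      have : 0 ≤ b := (abs_nonneg _).trans (hLb' j j)
      have : 0 ≤ 2 * D * b := by rw [hD]; positivity
      nlinarith
    have hmargin : 2 * D * b ≤ (1 - ξ) * (κ * L i i) := hκξ.trans (by gcongr; exact hLμ i)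
    calc |F i j - L i j| ≤ (|L i k| * κ + 2 * D * b) * η :=
          abs_sub_le_of_subdiagonal hF hL hFb hLb hdiag hadj hμ hημ hLμ hLb' hD hκη (by omega)
            hji hij (ih j k hk (by omega) (by omega))
      _ ≤ (ξ * L i i * κ + (1 - ξ) * (κ * L i i)) * η := by gcongr
      _ = κ * η * L i i := by ring

lemma abs_sub_le_of_completesZeros (hκξ : 2 * D * b ≤ (1 - ξ) * (κ * μ))
    (hratio : ∀ i j : Fin p, (i : ℕ) + 2 = j → (j : ℕ) + 1 < p → |L j i| / L j j ≤ ξ)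
    (i j : Fin p) : |F i j - L i j| ≤ (1 + (b * κ + 2 * D * b)) * η := by
  have : 0 ≤ b := (abs_nonneg _).trans (hLb' j j)
  have : 0 ≤ η := (abs_nonneg _).trans (hdiag j)
  have : 0 ≤ D := by rw [hD]; positivity
  by_cases hsub : (j : ℕ) + 1 = i → (j : ℕ) = 0 ∨ G.Adj i j
  · calc |F i j - L i j| ≤ 1 * η :=
          (abs_sub_le_of_subdiagonal_imp hF hL hFb hLb hdiag hadj hsub).trans_eq (one_mul η).symm
      _ ≤ (1 + (b * κ + 2 * D * b)) * η := by
          gcongr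
          exact le_add_of_nonneg_right (by positivity)
  · push Not at hsub
    obtain ⟨hji, hj0, hij⟩ := hsub
    obtain ⟨k, hk⟩ : ∃ k : Fin p, (k : ℕ) + 1 = j := ⟨⟨j - 1, by omega⟩, by dsimp only; omega⟩
    have hjk := abs_sub_le_mul_diagonal hF hL hFb hLb hdiag hadj hμ hημ hLμ hLb' hD hκ hκη hκμ hκξ
      hratio k j k rfl hk (by omega)
    calc |F i j - L i j| ≤ (|L i k| * κ + 2 * D * b) * η :=
          abs_sub_le_of_subdiagonal hF hL hFb hLb hdiag hadj hμ hημ hLμ hLb' hD hκη hk hji hij hjk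
      _ ≤ (b * κ + 2 * D * b) * η := by
          gcongr
          exact hLb' i k
      _ ≤ (1 + (b * κ + 2 * D * b)) * η :=
          mul_le_mul_of_nonneg_right (le_add_of_nonneg_left zero_le_one) ‹0 ≤ η›

end Propagation

lemma exists_abs_sub_le_of_completesZeros {b ξ μ : ℝ} (hb : 0 ≤ b) (hξ : ξ < 1) (hμ : 0 < μ) :
    ∃ C η₀ : ℝ, 0 < C ∧ 0 < η₀ ∧
    ∀ (p : ℕ) (G : SimpleGraph (Fin p)) (F L : Matrix (Fin p) (Fin p) ℝ) (η : ℝ),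
      CompletesZeros G F → CompletesZeros G L → IsLowerBanded F 2 → IsLowerBanded L 2 →
      (∀ i, |F i i - L i i| ≤ η) → (∀ i j, G.Adj i j → |F i j - L i j| ≤ η) →
      (∀ i, μ ≤ L i i) → (∀ i j, |L i j| ≤ b) →
      (∀ i j : Fin p, (i : ℕ) + 2 = j → (j : ℕ) + 1 < p → |L j i| / L j j ≤ ξ) → η ≤ η₀ →
      ∀ i j, |F i j - L i j| ≤ C * η := by
  have hξ' : 0 < 1 - ξ := sub_pos.mpr hξ
  obtain ⟨D, hD⟩ : ∃ D, D = 2 / μ + 2 * b / μ ^ 2 := ⟨_, rfl⟩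
  have hD0 : 0 ≤ D := by rw [hD]; positivity
  set κ := 1 / μ + 2 * D * b / ((1 - ξ) * μ)
  have hκ : 0 < κ := by positivity
  have hκμ : κ * μ = 1 + 2 * D * b / (1 - ξ) := by
    simp only [κ]
    field_simp
  refine ⟨1 + (b * κ + 2 * D * b), min (μ / 2) (1 / κ), by positivity, by positivity, ?_⟩
  intro p G F L η hF hL hFb hLb hdiag hadj hLμ hLb' hratio hη
  obtain ⟨hημ, hηκ⟩ := le_min_iff.mp hη
  refine abs_sub_le_of_completesZeros hF hL hFb hLb hdiag hadj hμ hημ hLμ hLb' hD hκ.le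
    ((le_div_iff₀' hκ).mp hηκ) ?_ ?_ hratio
  · rw [hκμ]
    exact le_add_of_nonneg_right (by positivity)
  · rw [hκμ, mul_add, mul_div_cancel₀ _ hξ'.ne', mul_one]
    exact le_add_of_nonneg_left hξ'.le

end StepTwo

/-! ### The estimator at a perturbed covariance matrix -/

section Estimator

lemma exists_abs_ccaL_sub_le {δ ξ : ℝ} (hδ : 0 < δ) (hξ : ξ < 1) : ∃ C ε₀ : ℝ, 0 < C ∧ 0 < ε₀ ∧
    ∀ (p : ℕ) (G : SimpleGraph (Fin p)) (L Ω S : Matrix (Fin p) (Fin p) ℝ) (ε : ℝ),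
      HasBandwidthLE G 2 → Ω ∈ concentrationSet G → spectrum ℝ Ω ⊆ Set.Icc δ δ⁻¹ →
      IsCholeskyFactor L Ω →
      (∀ i j : Fin p, (i : ℕ) + 2 = j → (j : ℕ) + 1 < p → |L j i| / L j j ≤ ξ) →
      0 ≤ ε → ε ≤ ε₀ → (∀ i j, |S i j - Ω⁻¹ i j| ≤ ε) →
      ∀ i j, |ccaL G S i j - L i j| ≤ C * ε := by
  have hδ' : 0 ≤ δ⁻¹ := inv_nonneg.mpr hδ.le
  obtain ⟨C₁, ε₁, hC₁, hε₁, hstepOne⟩ := exists_abs_stepOne_sub_le 2 hδ hδ'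
  obtain ⟨C₂, η₂, hC₂, hη₂, hstepTwo⟩ :=
    exists_abs_sub_le_of_completesZeros (Real.sqrt_nonneg δ⁻¹) hξ (Real.sqrt_pos.mpr hδ)
  refine ⟨C₂ * C₁, min ε₁ (η₂ / C₁), by positivity, by positivity, ?_⟩
  intro p G L Ω S ε hG hΩ hspec hL hratio hε hεε hS
  obtain ⟨hεε₁, hεη₂⟩ := le_min_iff.mp hεε
  have hspec' := spectrum_inv_subset_Icc hΩ.1.isUnit hδ hspec
  have hΩ_le (i : Fin p) : Ω i i ≤ δ⁻¹ :=
    apply_self_le_of_spectrum hΩ.1.isHermitian (fun t ht => (hspec ht).2) i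
  have hΩinv_le (i : Fin p) : Ω⁻¹ i i ≤ δ⁻¹ :=
    apply_self_le_of_spectrum hΩ.1.inv.isHermitian (fun t ht => (hspec' ht).2) i
  have hLzeros := hL.completesZeros hΩ
  have hfill := FillAdj.hasBandwidthLE hG
  have hLfill (i j : Fin p) (hji : j < i) : ¬ (filledGraph G).Adj i j → L i j = 0 :=
    hLzeros.eq_zero_of_not_fillAdj hji
  have hresid (j : Fin p) : δ ≤ residVar (filledGraph G) Ω⁻¹ j := by
    rw [residVar_inv hL hΩ.1 hLfill, le_inv_comm₀ hδ (pow_pos (hL.diag_pos j) 2)]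
    exact (Real.le_sqrt' (hL.diag_pos j)).mp
      ((le_abs_self _).trans (hL.abs_apply_le_sqrt hΩ_le j j))
  have hone : ∀ i j, |stepOne (filledGraph G) S i j - L i j| ≤ C₁ * ε := by
    simpa only [stepOne_inv hL hΩ.1 hLfill] using hstepOne p (filledGraph G) Ω⁻¹ S ε hfill
      (coerciveWith_of_spectrum hΩ.1.inv.isHermitian fun t ht => (hspec' ht).1)
      (abs_apply_le_of_posSemidef hΩ.1.inv.posSemidef hΩinv_le) hresid hε hεε₁ hS
  rw [mul_assoc]
  refine hstepTwo p G (ccaL G S) L (C₁ * ε) (completesZeros_ccaL S) hLzeros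
    ((completesZeros_ccaL S).isLowerBanded (fun i j => ccaL_apply_eq_zero S) hG)
    (hLzeros.isLowerBanded hL.lower hG) (fun i => ?_) (fun i j hij => ?_)
    (fun i => hL.sqrt_le_apply_self hδ (hΩinv_le i)) (hL.abs_apply_le_sqrt hΩ_le) hratio
    ((le_div_iff₀' hC₁).mp hεη₂)
  · rw [ccaL_apply_self]
    exact hone i i
  · rw [ccaL_apply_of_adj S hij]
    exact hone i j

end Estimator

/-! ### Frobenius norms of banded matrices -/

section Frobenius

variable {p w : ℕ} {B b : ℝ} {F L M : Matrix (Fin p) (Fin p) ℝ}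

lemma frobenius_norm_le_of_banded (hB : 0 ≤ B) (hM : ∀ i j, |M i j| ≤ B)
    (hband : ∀ i j, M i j ≠ 0 → (i : ℕ) ≤ j + w ∧ (j : ℕ) ≤ i + w) :
    ‖M‖ ≤ √(2 * w + 1) * B * √p := by
  have hrow (i : Fin p) : ∑ j, M i j ^ 2 ≤ (2 * w + 1) * B ^ 2 := by
    have hcard : (Finset.univ.filter fun j : Fin p =>
        (i : ℕ) ≤ j + w ∧ (j : ℕ) ≤ i + w).card ≤ 2 * w + 1 :=
      card_le_of_forall_lt_add (a := i - w) fun j hj => by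
        have := (Finset.mem_filter.mp hj).2
        omega
    have hsum := abs_sum_le_of_card_le hcard (sq_nonneg B) (f := fun j => M i j ^ 2)
      (fun j hj => by
        by_contra hne
        exact hj (by simpa using hband i j (pow_ne_zero_iff two_ne_zero |>.mp hne)))
      (fun j => by
        rw [abs_pow]
        exact pow_le_pow_left₀ (abs_nonneg _) (hM i j) 2)
    exact_mod_cast (le_abs_self _).trans hsum
  rw [Matrix.frobenius_norm_def, ← Real.sqrt_eq_rpow]
  simp only [Real.rpow_two, Real.norm_eq_abs, sq_abs]
  calc √(∑ i, ∑ j, M i j ^ 2) ≤ √(∑ _i : Fin p, (2 * w + 1) * B ^ 2) :=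
        Real.sqrt_le_sqrt (Finset.sum_le_sum fun i _ => hrow i)
    _ = √((2 * w + 1) * B ^ 2 * p) := by simp [mul_comm]
    _ = √(2 * w + 1) * B * √p := by
        rw [Real.sqrt_mul (by positivity), Real.sqrt_mul (by positivity), Real.sqrt_sq hB]

namespace IsLowerBanded

variable (hF : IsLowerBanded F w) (hL : IsLowerBanded L w)

include hF

lemma banded_mul_transpose (i j : Fin p) (hij : (F * Fᵀ) i j ≠ 0) :
    (i : ℕ) ≤ j + w ∧ (j : ℕ) ≤ i + w := by
  rw [Matrix.mul_apply] at hij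
  obtain ⟨k, -, hk⟩ := Finset.exists_ne_zero_of_sum_ne_zero hij
  rw [Matrix.transpose_apply, mul_ne_zero_iff] at hk
  have hik := hF i k hk.1
  have hjk := hF j k hk.2
  rw [Fin.le_def] at hik hjk
  omega

include hL

lemma norm_sub_le (hB : 0 ≤ B) (hFL : ∀ i j, |F i j - L i j| ≤ B) :
    ‖F - L‖ ≤ √(2 * w + 1) * B * √p := by
  refine frobenius_norm_le_of_banded hB hFL fun i j hij => ?_
  have hne : F i j ≠ 0 ∨ L i j ≠ 0 := by
    by_contra! h
    exact hij (by rw [Matrix.sub_apply, h.1, h.2, sub_zero])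
  have hband := hne.elim (hF i j) (hL i j)
  rw [Fin.le_def] at hband
  omega

lemma abs_mul_transpose_sub_le (hb : ∀ i j, |L i j| ≤ b) (hFL : ∀ i j, |F i j - L i j| ≤ B)
    (i j : Fin p) :
    |(F * Fᵀ - L * Lᵀ) i j| ≤ (w + 1) * ((b + B) * B + B * b) := by
  have : 0 ≤ b := (abs_nonneg _).trans (hb i i)
  have : 0 ≤ B := (abs_nonneg _).trans (hFL i i)
  have hF_le : ∀ i j, |F i j| ≤ b + B := fun i j => by
    linarith [abs_sub_abs_le_abs_sub (F i j) (L i j), hb i j, hFL i j]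
  have hcard : (Finset.univ.filter fun k : Fin p => k ≤ i ∧ (i : ℕ) ≤ k + w).card ≤ w + 1 :=
    card_le_of_forall_lt_add (a := i - w) fun k hk => by
      have := (Finset.mem_filter.mp hk).2
      rw [Fin.le_def] at this
      omega
  have hsplit : (F * Fᵀ - L * Lᵀ) i j = ∑ k, (F i k * F j k - L i k * L j k) := by
    simp [Matrix.mul_apply, Finset.sum_sub_distrib]
  rw [hsplit]
  refine (abs_sum_le_of_card_le hcard (by positivity) (fun k hk => ?_) fun k =>
    abs_mul_sub_mul_le (hF_le i k) (hb j k) (hFL i k) (hFL j k)).trans_eq (by push_cast; ring)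
  have hband : ¬ (k ≤ i ∧ (i : ℕ) ≤ k + w) := by simpa using hk
  rw [not_imp_comm.mp (hF i k) hband, not_imp_comm.mp (hL i k) hband, zero_mul, zero_mul, sub_zero]

lemma norm_mul_transpose_sub_le (hB : 0 ≤ B) (hb₀ : 0 ≤ b) (hb : ∀ i j, |L i j| ≤ b)
    (hFL : ∀ i j, |F i j - L i j| ≤ B) :
    ‖F * Fᵀ - L * Lᵀ‖ ≤ √(2 * w + 1) * ((w + 1) * ((b + B) * B + B * b)) * √p := by
  refine frobenius_norm_le_of_banded (by positivity) (hF.abs_mul_transpose_sub_le hL hb hFL)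
    fun i j hij => ?_
  have hne : (F * Fᵀ) i j ≠ 0 ∨ (L * Lᵀ) i j ≠ 0 := by
    by_contra! h
    exact hij (by rw [Matrix.sub_apply, h.1, h.2, sub_zero])
  exact hne.elim (hF.banded_mul_transpose i j) (hL.banded_mul_transpose i j)

end IsLowerBanded

lemma exists_norm_cca_sub_le {δ ξ : ℝ} (hδ : 0 < δ) (hξ : ξ < 1) : ∃ C C' ε₀ : ℝ,
    0 ≤ C ∧ 0 ≤ C' ∧ 0 < ε₀ ∧
    ∀ (p : ℕ) (G : SimpleGraph (Fin p)) (L Ω S : Matrix (Fin p) (Fin p) ℝ) (ε : ℝ),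
      HasBandwidthLE G 2 → Ω ∈ concentrationSet G → spectrum ℝ Ω ⊆ Set.Icc δ δ⁻¹ →
      IsCholeskyFactor L Ω →
      (∀ i j : Fin p, (i : ℕ) + 2 = j → (j : ℕ) + 1 < p → |L j i| / L j j ≤ ξ) →
      0 ≤ ε → ε ≤ ε₀ → (∀ i j, |S i j - Ω⁻¹ i j| ≤ ε) →
      ‖ccaL G S - L‖ ≤ C * (ε * √p) ∧ ‖ccaOmega G S - Ω‖ ≤ C' * (ε * √p) := by
  obtain ⟨C, ε₀, hC, hε₀, hcca⟩ := exists_abs_ccaL_sub_le hδ hξ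
  set b := √δ⁻¹
  have hb₀ : 0 ≤ b := Real.sqrt_nonneg _
  refine ⟨√(2 * (2 : ℕ) + 1) * C, √(2 * (2 : ℕ) + 1) * (((2 : ℕ) + 1) * ((b + 1) * C + C * b)),
    min ε₀ (1 / C), by positivity, by positivity, by positivity, ?_⟩
  intro p G L Ω S ε hG hΩ hspec hL hratio hε hεε hS
  obtain ⟨hεε₀, hεC⟩ := le_min_iff.mp hεε
  have hCε : C * ε ≤ 1 := (le_div_iff₀' hC).mp hεC
  have hentry := hcca p G L Ω S ε hG hΩ hspec hL hratio hε hεε₀ hS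
  have hF : IsLowerBanded (ccaL G S) 2 :=
    (completesZeros_ccaL S).isLowerBanded (fun i j => ccaL_apply_eq_zero S) hG
  have hLb : IsLowerBanded L 2 := (hL.completesZeros hΩ).isLowerBanded hL.lower hG
  have hb : ∀ i j, |L i j| ≤ b := hL.abs_apply_le_sqrt
    (apply_self_le_of_spectrum hΩ.1.isHermitian fun t ht => (hspec ht).2)
  constructor
  · refine (hF.norm_sub_le hLb (by positivity) hentry).trans_eq ?_
    ring
  · rw [ccaOmega, hL.eq]
    refine (hF.norm_mul_transpose_sub_le hLb (by positivity) hb₀ hb hentry).trans ?_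
    calc _ ≤ √(2 * (2 : ℕ) + 1) * (((2 : ℕ) + 1) * ((b + 1) * (C * ε) + C * ε * b)) * √p := by
          gcongr
      _ = _ := by ring

end Frobenius

/-! ### Exponential moments and concentration -/

section Concentration

variable {X : Type*} [MeasurableSpace X] {P : Measure X}

/-- The random variable `W` has an exponential moment of order `s`, bounded by `M`:
`E exp (s |W|) ≤ M`. Integrability is part of the notion, since the Bochner integral of a
function that is not integrable is `0`. -/
structure HasExpMomentLE (W : X → ℝ) (s M : ℝ) (P : Measure X) : Prop where
  measurable : Measurable W
  integrable_exp : Integrable (fun ω => Real.exp (s * |W ω|)) P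
  integral_exp_le : ∫ ω, Real.exp (s * |W ω|) ∂P ≤ M

lemma lintegral_exp_neg_mul_sq_add_mul {b : ℝ} (hb : 0 < b) (z : ℝ) :
    ∫⁻ u : ℝ, ENNReal.ofReal (Real.exp (-b * u ^ 2 + u * z))
      = ENNReal.ofReal (Real.exp (1 / (4 * b) * z ^ 2)) * ENNReal.ofReal √(Real.pi / b) := by
  have hsquare : ∀ u : ℝ, Real.exp (-b * u ^ 2 + u * z)
      = Real.exp (1 / (4 * b) * z ^ 2) * Real.exp (-b * (u - z / (2 * b)) ^ 2) := by
    intro u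
    rw [← Real.exp_add]
    congr 1
    field_simp
    ring
  have hint : Integrable fun u : ℝ => Real.exp (-b * (u - z / (2 * b)) ^ 2) :=
    (integrable_exp_neg_mul_sq hb).comp_sub_right (z / (2 * b))
  simp_rw [hsquare]
  rw [← ofReal_integral_eq_lintegral_ofReal (hint.const_mul _)
    (Eventually.of_forall fun u => by positivity), integral_const_mul,
    integral_sub_right_eq_self (fun u : ℝ => Real.exp (-b * u ^ 2)), integral_gaussian,
    ENNReal.ofReal_mul (by positivity)]

lemma lintegral_exp_neg_mul_sq_add_mul_le {Z : X → ℝ} {v : NNReal} (h : HasSubgaussianMGF Z v P)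
    (u : ℝ) : ∫⁻ ω, ENNReal.ofReal (Real.exp (-v * u ^ 2 + u * Z ω)) ∂P
      ≤ ENNReal.ofReal (Real.exp (-(v / 2) * u ^ 2 + u * 0)) := by
  simp_rw [Real.exp_add]
  rw [← ofReal_integral_eq_lintegral_ofReal ((h.integrable_exp_mul u).const_mul _)
    (Eventually.of_forall fun ω => by positivity), integral_const_mul]
  refine ENNReal.ofReal_le_ofReal ?_
  calc Real.exp (-v * u ^ 2) * mgf Z P u
      ≤ Real.exp (-v * u ^ 2) * Real.exp (v * u ^ 2 / 2) := by
        gcongr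
        exact h.mgf_le u
    _ = Real.exp (-(v / 2) * u ^ 2) * Real.exp (u * 0) := by
        rw [← Real.exp_add, ← Real.exp_add]
        ring_nf

-- `exp (z² / (4 v))` is, up to a constant, the integral of `exp (u z)` against a Gaussian weight
-- in `u`; exchanging the integrals brings in the moment generating function of `Z`.
lemma lintegral_exp_mul_sq_le [SFinite P] {Z : X → ℝ} (hZ : Measurable Z) {v : NNReal}
    (hv : 0 < v) (h : HasSubgaussianMGF Z v P) :
    ∫⁻ ω, ENNReal.ofReal (Real.exp (1 / (4 * v) * Z ω ^ 2)) ∂P ≤ ENNReal.ofReal √2 := by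
  have hv' : (0 : ℝ) < v := hv
  set a : ENNReal := ENNReal.ofReal √(Real.pi / v) with ha
  have ha₀ : a ≠ 0 := by
    rw [ha, Ne, ENNReal.ofReal_eq_zero, not_le]
    positivity
  refine (ENNReal.mul_le_mul_iff_left ha₀ ENNReal.ofReal_ne_top).mp ?_
  calc (∫⁻ ω, ENNReal.ofReal (Real.exp (1 / (4 * v) * Z ω ^ 2)) ∂P) * a
      = ∫⁻ ω, (∫⁻ u : ℝ, ENNReal.ofReal (Real.exp (-v * u ^ 2 + u * Z ω))) ∂P := by
        rw [← lintegral_mul_const _ (by fun_prop)]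
        simp_rw [lintegral_exp_neg_mul_sq_add_mul hv', ha]
    _ = ∫⁻ u : ℝ, ∫⁻ ω, ENNReal.ofReal (Real.exp (-v * u ^ 2 + u * Z ω)) ∂P := by
        refine lintegral_lintegral_swap (Measurable.aemeasurable ?_)
        unfold Function.uncurry
        fun_prop
    _ ≤ ∫⁻ u : ℝ, ENNReal.ofReal (Real.exp (-(v / 2) * u ^ 2 + u * 0)) :=
        lintegral_mono (lintegral_exp_neg_mul_sq_add_mul_le h)
    _ = ENNReal.ofReal √2 * a := by
        rw [lintegral_exp_neg_mul_sq_add_mul (by positivity), ha,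
          ← ENNReal.ofReal_mul (Real.sqrt_nonneg 2), ← Real.sqrt_mul (by norm_num)]
        simp only [ne_eq, OfNat.ofNat_ne_zero, not_false_eq_true, zero_pow, mul_zero,
          Real.exp_zero, ENNReal.ofReal_one, one_mul]
        congr 2
        field_simp

lemma hasExpMomentLE_sq_of_hasSubgaussianMGF [SFinite P] {Z : X → ℝ} (hZ : Measurable Z)
    {v : NNReal} (hv : 0 < v) (h : HasSubgaussianMGF Z v P) :
    HasExpMomentLE (fun ω => Z ω ^ 2) (1 / (4 * v)) √2 P := by
  have hle := lintegral_exp_mul_sq_le hZ hv h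
  have hint : Integrable (fun ω => Real.exp (1 / (4 * v) * Z ω ^ 2)) P := by
    refine ⟨by fun_prop, ?_⟩
    rw [hasFiniteIntegral_iff_ofReal (Eventually.of_forall fun ω => by positivity)]
    exact hle.trans_lt ENNReal.ofReal_lt_top
  rw [← ofReal_integral_eq_lintegral_ofReal hint (Eventually.of_forall fun ω => by positivity),
    ENNReal.ofReal_le_ofReal_iff (Real.sqrt_nonneg 2)] at hle
  exact ⟨hZ.pow_const 2, by simpa only [abs_sq] using hint, by simpa only [abs_sq] using hle⟩

lemma exp_le_one_add_add_sq_mul (x : ℝ) : Real.exp x ≤ 1 + x + x ^ 2 * Real.exp |x| := by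
  have hexp : 1 ≤ Real.exp |x| := Real.one_le_exp (abs_nonneg x)
  rcases le_total |x| 1 with hx | hx
  · have htaylor := (abs_le.mp (Real.abs_exp_sub_one_sub_id_le hx)).2
    have hsq : x ^ 2 ≤ x ^ 2 * Real.exp |x| := le_mul_of_one_le_right (sq_nonneg x) hexp
    linarith
  · have hx₂ : |x| ≤ x ^ 2 := by
      rw [← sq_abs]
      exact le_self_pow₀ hx two_ne_zero
    have hmono : Real.exp x ≤ Real.exp |x| := Real.exp_le_exp.mpr (le_abs_self x)
    nlinarith [neg_abs_le x]

lemma exp_mul_le_one_add_mul_add {l s : ℝ} (hs : 0 < s) (hl : |l| ≤ s / 2) (w : ℝ) :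
    Real.exp (l * w) ≤ 1 + l * w + 8 / s ^ 2 * l ^ 2 * Real.exp (s * |w|) := by
  refine (exp_le_one_add_add_sq_mul _).trans ?_
  gcongr 1 + l * w + ?_
  have hy : 0 ≤ s / 2 * |w| := by positivity
  have hquad : (s / 2 * |w|) ^ 2 / 2 ≤ Real.exp (s / 2 * |w|) := by
    linarith [Real.quadratic_le_exp_of_nonneg hy]
  calc (l * w) ^ 2 * Real.exp |l * w|
      = 8 / s ^ 2 * l ^ 2 * ((s / 2 * |w|) ^ 2 / 2 * Real.exp |l * w|) := by
        rw [mul_pow, mul_pow, sq_abs]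
        field_simp
        ring
    _ ≤ 8 / s ^ 2 * l ^ 2 * (Real.exp (s / 2 * |w|) * Real.exp (s / 2 * |w|)) := by
        rw [abs_mul l w]
        gcongr
    _ = 8 / s ^ 2 * l ^ 2 * Real.exp (s * |w|) := by
        rw [← Real.exp_add]
        ring_nf

lemma le_exp_self (x : ℝ) : x ≤ Real.exp x :=
  (le_add_of_nonneg_right zero_le_one).trans (Real.add_one_le_exp _)

namespace HasExpMomentLE

variable {U V W : X → ℝ} {s M : ℝ}

lemma neg (hW : HasExpMomentLE W s M P) : HasExpMomentLE (-W) s M P :=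
  ⟨hW.measurable.neg, by simpa using hW.integrable_exp, by simpa using hW.integral_exp_le⟩

lemma of_exp_le (hW : HasExpMomentLE W s M P) (hU : Measurable U) {K : ℝ} (hK : 0 ≤ K)
    (h : ∀ ω, Real.exp (s * |U ω|) ≤ K * Real.exp (s * |W ω|)) :
    HasExpMomentLE U s (K * M) P := by
  have hint : Integrable (fun ω => Real.exp (s * |U ω|)) P :=
    (hW.integrable_exp.const_mul K).mono' (by fun_prop)
      (Eventually.of_forall fun ω => by simpa only [Real.norm_eq_abs, Real.abs_exp] using h ω)
  refine ⟨hU, hint, (integral_mono hint (hW.integrable_exp.const_mul K) h).trans ?_⟩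
  rw [integral_const_mul]
  exact mul_le_mul_of_nonneg_left hW.integral_exp_le hK

lemma mul (hs : 0 < s) (hU : Measurable U) (hV : Measurable V)
    (hU₂ : HasExpMomentLE (fun ω => U ω ^ 2) s M P)
    (hV₂ : HasExpMomentLE (fun ω => V ω ^ 2) s M P) :
    HasExpMomentLE (fun ω => U ω * V ω) s M P := by
  have hle : ∀ ω, Real.exp (s * |U ω * V ω|)
      ≤ (Real.exp (s * |U ω ^ 2|) + Real.exp (s * |V ω ^ 2|)) / 2 := by
    intro ω
    have hmul : s * |U ω * V ω| ≤ s * |U ω ^ 2| / 2 + s * |V ω ^ 2| / 2 := by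
      rw [abs_mul, abs_pow, abs_pow]
      nlinarith [sq_nonneg (|U ω| - |V ω|)]
    have hhalf : ∀ x : ℝ, Real.exp x = Real.exp (x / 2) ^ 2 := fun x => by
      rw [← Real.exp_nat_mul]
      ring_nf
    refine (Real.exp_le_exp.mpr hmul).trans ?_
    rw [Real.exp_add, hhalf (s * |U ω ^ 2|), hhalf (s * |V ω ^ 2|)]
    linarith [two_mul_le_add_sq (Real.exp (s * |U ω ^ 2| / 2)) (Real.exp (s * |V ω ^ 2| / 2))]
  have hsum : Integrable
      (fun ω => (Real.exp (s * |U ω ^ 2|) + Real.exp (s * |V ω ^ 2|)) / 2) P :=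
    (hU₂.integrable_exp.add hV₂.integrable_exp).div_const 2
  have hint : Integrable (fun ω => Real.exp (s * |U ω * V ω|)) P :=
    hsum.mono' (by fun_prop)
      (Eventually.of_forall fun ω => by simpa only [Real.norm_eq_abs, Real.abs_exp] using hle ω)
  refine ⟨hU.mul hV, hint, (integral_mono hint hsum hle).trans ?_⟩
  rw [integral_div, integral_add hU₂.integrable_exp hV₂.integrable_exp]
  linarith [hU₂.integral_exp_le, hV₂.integral_exp_le]

lemma integrable (hW : HasExpMomentLE W s M P) (hs : 0 < s) : Integrable W P := by
  refine (hW.integrable_exp.const_mul s⁻¹).mono' hW.measurable.aestronglyMeasurable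
    (Eventually.of_forall fun ω => ?_)
  rw [Real.norm_eq_abs, ← div_eq_inv_mul, le_div_iff₀' hs]
  exact le_exp_self _

lemma mul_abs_integral_le (hW : HasExpMomentLE W s M P) (hs : 0 < s) :
    s * |∫ ω, W ω ∂P| ≤ M :=
  calc s * |∫ ω, W ω ∂P| ≤ s * ∫ ω, |W ω| ∂P := by gcongr; exact abs_integral_le_integral_abs
    _ = ∫ ω, s * |W ω| ∂P := (integral_const_mul _ _).symm
    _ ≤ ∫ ω, Real.exp (s * |W ω|) ∂P :=
        integral_mono ((hW.integrable hs).abs.const_mul s) hW.integrable_exp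
          fun ω => le_exp_self _
    _ ≤ M := hW.integral_exp_le

lemma sub_integral (hW : HasExpMomentLE W s M P) (hs : 0 < s) :
    HasExpMomentLE (fun ω => W ω - ∫ ω', W ω' ∂P) s (Real.exp M * M) P := by
  refine hW.of_exp_le (hW.measurable.sub_const _) (Real.exp_nonneg M) fun ω => ?_
  rw [← Real.exp_add, Real.exp_le_exp]
  calc s * |W ω - ∫ ω', W ω' ∂P| ≤ s * (|W ω| + |∫ ω', W ω' ∂P|) := by
        gcongr
        exact abs_sub _ _
    _ ≤ M + s * |W ω| := by linarith [hW.mul_abs_integral_le hs]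

variable {l : ℝ}

lemma integrable_exp_mul (hW : HasExpMomentLE W s M P) (hl : |l| ≤ s) :
    Integrable (fun ω => Real.exp (l * W ω)) P := by
  have := hW.measurable
  refine hW.integrable_exp.mono' (by fun_prop) (Eventually.of_forall fun ω => ?_)
  rw [Real.norm_eq_abs, Real.abs_exp, Real.exp_le_exp]
  calc l * W ω ≤ |l| * |W ω| := (le_abs_self _).trans_eq (abs_mul _ _)
    _ ≤ s * |W ω| := by gcongr

lemma mgf_le [IsProbabilityMeasure P] (hW : HasExpMomentLE W s M P) (hs : 0 < s)
    (hmean : ∫ ω, W ω ∂P = 0) (hl : |l| ≤ s / 2) :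
    mgf W P l ≤ Real.exp (8 * M / s ^ 2 * l ^ 2) := by
  have hlin : Integrable (fun ω => 1 + l * W ω) P :=
    (integrable_const 1).add ((hW.integrable hs).const_mul l)
  calc mgf W P l = ∫ ω, Real.exp (l * W ω) ∂P := rfl
    _ ≤ ∫ ω, (1 + l * W ω + 8 / s ^ 2 * l ^ 2 * Real.exp (s * |W ω|)) ∂P :=
        integral_mono (hW.integrable_exp_mul (by linarith))
          (hlin.add (hW.integrable_exp.const_mul _))
          fun ω => exp_mul_le_one_add_mul_add hs hl (W ω)
    _ = 1 + 8 / s ^ 2 * l ^ 2 * ∫ ω, Real.exp (s * |W ω|) ∂P := by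
        rw [integral_add hlin (hW.integrable_exp.const_mul _),
          integral_add (integrable_const 1) ((hW.integrable hs).const_mul l),
          integral_const_mul, integral_const_mul, hmean]
        simp
    _ ≤ 1 + 8 / s ^ 2 * l ^ 2 * M := by
        gcongr
        exact hW.integral_exp_le
    _ = 8 * M / s ^ 2 * l ^ 2 + 1 := by ring
    _ ≤ Real.exp (8 * M / s ^ 2 * l ^ 2) := Real.add_one_le_exp _

end HasExpMomentLE

section Bernstein

variable {ι : Type*} [Fintype ι] {W : ι → X → ℝ} {s M t : ℝ}

lemma measureReal_sum_ge_le_of_hasExpMomentLE (hind : iIndepFun W P)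
    (hW : ∀ i, HasExpMomentLE (W i) s M P) (hmean : ∀ i, ∫ ω, W i ω ∂P = 0) (hs : 0 < s)
    (hM : 0 < M) (ht₀ : 0 ≤ t) (ht : t ≤ 8 * M / s) :
    P.real {ω | Fintype.card ι * t ≤ ∑ i, W i ω}
      ≤ Real.exp (-(Fintype.card ι * t ^ 2 / (4 * (8 * M / s ^ 2)))) := by
  have := hind.isProbabilityMeasure
  set C : ℝ := 8 * M / s ^ 2 with hC
  have hC₀ : 0 < C := by positivity
  -- the minimizer of `C l² - l t`
  set l : ℝ := t / (2 * C) with hl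
  have hl₀ : 0 ≤ l := by positivity
  have hls : |l| ≤ s / 2 := by
    rw [abs_of_nonneg hl₀, hl, div_le_iff₀ (by positivity)]
    refine ht.trans_eq ?_
    rw [hC]
    field_simp
  have hchernoff := measure_ge_le_exp_mul_mgf (Fintype.card ι * t) hl₀
    (hind.integrable_exp_mul_sum (fun i => (hW i).measurable) (s := Finset.univ)
      fun i _ => (hW i).integrable_exp_mul (hls.trans (by linarith)))
  simp only [Finset.sum_apply] at hchernoff
  refine hchernoff.trans ?_
  rw [hind.mgf_sum (fun i => (hW i).measurable)]
  calc Real.exp (-l * (Fintype.card ι * t)) * ∏ i, mgf (W i) P l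
      ≤ Real.exp (-l * (Fintype.card ι * t)) * ∏ _i : ι, Real.exp (C * l ^ 2) := by
        gcongr with i
        · exact fun i _ => mgf_nonneg
        · exact (hW i).mgf_le hs (hmean i) hls
    _ = Real.exp (-(Fintype.card ι * t ^ 2 / (4 * C))) := by
        rw [Finset.prod_const, Finset.card_univ, ← Real.exp_nat_mul, ← Real.exp_add, hl]
        congr 1
        field_simp
        ring

lemma measureReal_abs_sum_ge_le_of_hasExpMomentLE (hind : iIndepFun W P)
    (hW : ∀ i, HasExpMomentLE (W i) s M P) (hmean : ∀ i, ∫ ω, W i ω ∂P = 0) (hs : 0 < s)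
    (hM : 0 < M) (ht₀ : 0 ≤ t) (ht : t ≤ 8 * M / s) :
    P.real {ω | Fintype.card ι * t ≤ |∑ i, W i ω|}
      ≤ 2 * Real.exp (-(Fintype.card ι * t ^ 2 / (4 * (8 * M / s ^ 2)))) := by
  have := hind.isProbabilityMeasure
  have hpos := measureReal_sum_ge_le_of_hasExpMomentLE hind hW hmean hs hM ht₀ ht
  have hneg := measureReal_sum_ge_le_of_hasExpMomentLE (W := fun i => -W i)
    (hind.comp (fun _ x => -x) fun _ => measurable_neg) (fun i => (hW i).neg)
    (fun i => by simp [integral_neg, hmean i]) hs hM ht₀ ht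
  have hunion : {ω | Fintype.card ι * t ≤ |∑ i, W i ω|}
      = {ω | Fintype.card ι * t ≤ ∑ i, W i ω} ∪ {ω | Fintype.card ι * t ≤ ∑ i, (-W i) ω} := by
    ext ω
    simp only [Set.mem_ofPred_eq, Set.mem_union, le_abs, Pi.neg_apply, Finset.sum_neg_distrib]
  rw [hunion]
  linarith [measureReal_union_le (μ := P) {ω | Fintype.card ι * t ≤ ∑ i, W i ω}
    {ω | Fintype.card ι * t ≤ ∑ i, (-W i) ω}]

end Bernstein

lemma sampleCov_sub_apply {n p : ℕ} (hn : 0 < n) (y : Fin n → Fin p → ℝ)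
    (A : Matrix (Fin p) (Fin p) ℝ) (a b : Fin p) :
    sampleCov y a b - A a b = (∑ i, (y i a * y i b - A a b)) / n := by
  rw [Finset.sum_sub_distrib, sampleCov]
  simp only [Finset.sum_const, Finset.card_univ, Fintype.card_fin, nsmul_eq_mul]
  field_simp

section SampleCov

variable {n p : ℕ} {Y : Fin n → X → Fin p → ℝ} {A : Matrix (Fin p) (Fin p) ℝ} {s M t : ℝ}

lemma measureReal_abs_sampleCov_sub_ge_le (hn : 0 < n) (hmeas : ∀ i, Measurable (Y i))
    (hind : iIndepFun Y P) (hA : ∀ i a b, ∫ ω, Y i ω a * Y i ω b ∂P = A a b) (hs : 0 < s)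
    (hM : 0 < M) (hsq : ∀ i a, HasExpMomentLE (fun ω => Y i ω a ^ 2) s M P) (ht₀ : 0 ≤ t)
    (ht : t ≤ 8 * (Real.exp M * M) / s) (a b : Fin p) :
    P.real {ω | t ≤ |sampleCov (fun i => Y i ω) a b - A a b|}
      ≤ 2 * Real.exp (-(n * t ^ 2 / (4 * (8 * (Real.exp M * M) / s ^ 2)))) := by
  have := hind.isProbabilityMeasure
  have hcoord : ∀ i a, Measurable fun ω => Y i ω a := fun i => measurable_pi_iff.mp (hmeas i)
  have hprod : ∀ i, HasExpMomentLE (fun ω => Y i ω a * Y i ω b) s M P := fun i =>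
    .mul hs (hcoord i a) (hcoord i b) (hsq i a) (hsq i b)
  have hcentred : ∀ i, HasExpMomentLE (fun ω => Y i ω a * Y i ω b - A a b) s (Real.exp M * M) P :=
    fun i => by simpa only [hA] using (hprod i).sub_integral hs
  have hmean : ∀ i, ∫ ω, (Y i ω a * Y i ω b - A a b) ∂P = 0 := fun i => by
    rw [integral_sub ((hprod i).integrable hs) (integrable_const _), hA]
    simp
  have hprod_ind : iIndepFun (fun i ω => Y i ω a * Y i ω b - A a b) P :=
    hind.comp (fun _ y => y a * y b - A a b) fun _ => by fun_prop
  have hbernstein := measureReal_abs_sum_ge_le_of_hasExpMomentLE hprod_ind hcentred hmean hs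
    (by positivity) ht₀ ht
  have hn' : (0 : ℝ) < n := by exact_mod_cast hn
  simpa only [Fintype.card_fin, sampleCov_sub_apply hn, abs_div, Nat.abs_cast,
    le_div_iff₀' hn'] using hbernstein

lemma measureReal_compl_forall_abs_sub_lt_le {Z : X → Matrix (Fin p) (Fin p) ℝ}
    {q : ℝ} (h : ∀ a b, P.real {ω | t ≤ |Z ω a b - A a b|} ≤ q) :
    P.real {ω | ∀ a b, |Z ω a b - A a b| < t}ᶜ ≤ p ^ 2 * q := by
  have hunion : {ω | ∀ a b, |Z ω a b - A a b| < t}ᶜ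
      = ⋃ ab : Fin p × Fin p, {ω | t ≤ |Z ω ab.1 ab.2 - A ab.1 ab.2|} := by
    ext ω
    simp [Prod.exists]
  calc P.real {ω | ∀ a b, |Z ω a b - A a b| < t}ᶜ
      ≤ ∑ ab : Fin p × Fin p, P.real {ω | t ≤ |Z ω ab.1 ab.2 - A ab.1 ab.2|} := by
        rw [hunion]
        exact measureReal_iUnion_fintype_le _
    _ ≤ ∑ _ab : Fin p × Fin p, q := Finset.sum_le_sum fun ab _ => h ab.1 ab.2
    _ = p ^ 2 * q := by simp [sq]

lemma measureReal_compl_sampleCov_close_le (hn : 0 < n) (hp : 0 < p)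
    (hmeas : ∀ i, Measurable (Y i)) (hind : iIndepFun Y P)
    (hA : ∀ i a b, ∫ ω, Y i ω a * Y i ω b ∂P = A a b) (hs : 0 < s) (hM : 0 < M)
    (hsq : ∀ i a, HasExpMomentLE (fun ω => Y i ω a ^ 2) s M P)
    (ht : t = √(12 * (8 * (Real.exp M * M) / s ^ 2) * (Real.log p / n)))
    (hts : t ≤ 8 * (Real.exp M * M) / s) :
    P.real {ω | ∀ a b, |sampleCov (fun i => Y i ω) a b - A a b| < t}ᶜ ≤ 2 / p := by
  have hn' : (0 : ℝ) < n := by exact_mod_cast hn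
  have : (0 : ℝ) < p := by exact_mod_cast hp
  have ht₀ : 0 ≤ t := ht ▸ Real.sqrt_nonneg _
  have : 0 ≤ Real.log p / n := div_nonneg (Real.log_natCast_nonneg p) hn'.le
  have hexponent : n * t ^ 2 / (4 * (8 * (Real.exp M * M) / s ^ 2)) = Real.log ((p : ℝ) ^ 3) := by
    rw [ht, Real.sq_sqrt (by positivity), Real.log_pow]
    push_cast
    field_simp
    ring
  refine (measureReal_compl_forall_abs_sub_lt_le
    (measureReal_abs_sampleCov_sub_ge_le hn hmeas hind hA hs hM hsq ht₀ hts)).trans_eq ?_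
  rw [hexponent, Real.exp_neg, Real.exp_log (by positivity)]
  field_simp

end SampleCov

end Concentration

lemma tendsto_measure_one_of_compl_le {X : ℕ → Type*} [∀ n, MeasurableSpace (X n)]
    {P : ∀ n, Measure (X n)} [∀ n, IsProbabilityMeasure (P n)] {s : ∀ n, Set (X n)} {r : ℕ → ℝ}
    (hr : Tendsto r atTop (𝓝 0)) (hs : ∀ᶠ n in atTop, (P n).real (s n)ᶜ ≤ r n) :
    Tendsto (fun n => P n (s n)) atTop (𝓝 1) := by
  have hlow : Tendsto (fun n => 1 - ENNReal.ofReal (r n)) atTop (𝓝 1) := by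
    simpa using ENNReal.Tendsto.sub (tendsto_const_nhds (x := (1 : ENNReal)))
      (ENNReal.tendsto_ofReal hr) (Or.inl ENNReal.one_ne_top)
  refine tendsto_of_tendsto_of_tendsto_of_le_of_le' hlow tendsto_const_nhds ?_
    (Eventually.of_forall fun n => prob_le_one)
  filter_upwards [hs] with n hn
  rw [tsub_le_iff_right]
  calc (1 : ENNReal) = P n Set.univ := measure_univ.symm
    _ ≤ P n (s n) + P n (s n)ᶜ := measure_univ_le_add_compl (s n)
    _ ≤ P n (s n) + ENNReal.ofReal (r n) := by
        gcongr
        exact (ENNReal.le_ofReal_iff_toReal_le (measure_ne_top _ _)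
          (measureReal_nonneg.trans hn)).mpr hn

/-! ### Convergence rates -/

lemma hasSubgaussianMGF_apply {X : Type*} [MeasurableSpace X] {P : Measure X} {p : ℕ}
    {Y : X → Fin p → ℝ} {c : NNReal}
    (h : ∀ x : Fin p → ℝ, Integrable (fun ω => Real.exp (x ⬝ᵥ Y ω)) P ∧
      ∫ ω, Real.exp (x ⬝ᵥ Y ω) ∂P ≤ Real.exp (c * (x ⬝ᵥ x))) (a : Fin p) :
    HasSubgaussianMGF (fun ω => Y ω a) (2 * c) P where
  integrable_exp_mul t := by simpa using (h (Pi.single a t)).1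
  mgf_le t := by
    refine Eq.trans_le ?_ ((h (Pi.single a t)).2.trans_eq ?_)
    · simp [mgf]
    · simp only [single_dotProduct, Pi.single_eq_same, NNReal.coe_mul, NNReal.coe_ofNat]
      ring_nf

lemma sqrt_mul_mul_sqrt_le {a x q m : ℝ} (ha : 0 ≤ a) (hm : 0 ≤ m) (hqm : q ≤ m) :
    √(a * x) * √q ≤ √a * √(m * x) := by
  rw [Real.sqrt_mul ha, Real.sqrt_mul hm]
  calc √a * √x * √q = √a * (√q * √x) := by ring
    _ ≤ √a * (√m * √x) := by gcongr

lemma tendsto_log_div_of_tendsto_mul_log_div {p m : ℕ → ℕ} (hm : ∀ᶠ n in atTop, 1 ≤ m n)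
    (h : Tendsto (fun n : ℕ => (m n : ℝ) * Real.log (p n) / n) atTop (𝓝 0)) :
    Tendsto (fun n : ℕ => Real.log (p n) / n) atTop (𝓝 0) := by
  refine squeeze_zero' (Eventually.of_forall fun n => by positivity) ?_ h
  filter_upwards [hm] with n hn
  gcongr
  exact le_mul_of_one_le_left (Real.log_natCast_nonneg _) (by exact_mod_cast hn)

theorem lemma7_general
    (p : ℕ → ℕ) (hp : Tendsto p atTop atTop) (G : ∀ n, SimpleGraph (Fin (p n)))
    (hband : ∀ n, HasBandwidthLE (G n) 2) (hcard : ∀ n, p n ≤ (G n).edgeSet.ncard + 1)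
    (Ωbar Lbar : ∀ n, Matrix (Fin (p n)) (Fin (p n)) ℝ)
    (hΩ : ∀ n, Ωbar n ∈ concentrationSet (G n)) (hL : ∀ n, IsCholeskyFactor (Lbar n) (Ωbar n))
    {X : ℕ → Type*} [∀ n, MeasurableSpace (X n)]
    (P : ∀ n, Measure (X n)) [∀ n, IsProbabilityMeasure (P n)]
    (Y : ∀ n, Fin n → X n → Fin (p n) → ℝ) (hmeas : ∀ n i, Measurable (Y n i))
    (hind : ∀ n, iIndepFun (Y n) (P n))
    (hcov : ∀ n i a b, ∫ ω, Y n i ω a * Y n i ω b ∂(P n) = (Ωbar n)⁻¹ a b)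
    (hspec : ∃ δ : ℝ, 0 < δ ∧ ∀ n, ∀ t ∈ spectrum ℝ (Ωbar n), δ ≤ t ∧ t ≤ δ⁻¹)
    (hexp : ∃ c : ℝ, 0 < c ∧ ∀ n (i : Fin n) (x : Fin (p n) → ℝ),
      Integrable (fun ω => Real.exp (x ⬝ᵥ Y n i ω)) (P n) ∧
      ∫ ω, Real.exp (x ⬝ᵥ Y n i ω) ∂(P n) ≤ Real.exp (c * (x ⬝ᵥ x)))
    (hratio : ∃ ξ : ℝ, ξ < 1 ∧ ∀ n (i j : Fin (p n)), (i : ℕ) + 2 = j → (j : ℕ) + 1 < p n →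
      |Lbar n j i| / Lbar n j j ≤ ξ)
    (hrate : Tendsto (fun n : ℕ => Real.log (p n) / n) atTop (𝓝 0)) :
    ∃ K K' : ℝ,
      Tendsto (fun n : ℕ => P n {ω |
          ‖ccaL (G n) (sampleCov fun i => Y n i ω) - Lbar n‖
            ≤ K * √((((G n).edgeSet.ncard : ℝ) + 1) * Real.log (p n) / n) ∧
          ‖ccaOmega (G n) (sampleCov fun i => Y n i ω) - Ωbar n‖
            ≤ K' * √((((G n).edgeSet.ncard : ℝ) + 1) * Real.log (p n) / n)})
        atTop (𝓝 1) := by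
  obtain ⟨δ, hδ, hspec⟩ := hspec
  obtain ⟨c, hc, hexp⟩ := hexp
  obtain ⟨ξ, hξ, hratio⟩ := hratio
  lift c to NNReal using hc.le
  obtain ⟨C, C', ε₀, hC, hC', hε₀, hcca⟩ := exists_norm_cca_sub_le hδ hξ
  have hv : 0 < 2 * c := mul_pos two_pos hc
  set s : ℝ := 1 / (4 * (2 * c : NNReal))
  have hs : 0 < s := by positivity
  have hsq : ∀ n i a, HasExpMomentLE (fun ω => Y n i ω a ^ 2) s √2 (P n) := fun n i a =>
    hasExpMomentLE_sq_of_hasSubgaussianMGF (measurable_pi_iff.mp (hmeas n i) a) hv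
      (hasSubgaussianMGF_apply (hexp n i) a)
  set κ : ℝ := 12 * (8 * (Real.exp √2 * √2) / s ^ 2)
  have hκ : 0 ≤ κ := by positivity
  set t : ℕ → ℝ := fun n => √(κ * (Real.log (p n) / n)) with ht
  have hsmall : ∀ r : ℝ, 0 < r → ∀ᶠ n in atTop, t n ≤ r := fun r hr => by
    have hlim : Tendsto t atTop (𝓝 0) := by simpa [ht] using (hrate.const_mul κ).sqrt
    exact hlim.eventually_le_const hr
  have hp_inv : Tendsto (fun n => 2 / (p n : ℝ)) atTop (𝓝 0) :=
    (tendsto_natCast_atTop_atTop.comp hp).const_div_atTop 2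
  refine ⟨C * √κ, C' * √κ, tendsto_measure_one_of_compl_le hp_inv ?_⟩
  filter_upwards [hsmall ε₀ hε₀, hsmall (8 * (Real.exp √2 * √2) / s) (by positivity),
    eventually_gt_atTop 0, hp.eventually_gt_atTop 0] with n hnε hnt hn hpn
  refine (measureReal_mono (Set.compl_subset_compl.mpr fun ω hω => ?_)).trans
    (measureReal_compl_sampleCov_close_le hn hpn (hmeas n) (hind n) (hcov n) hs (by positivity)
      (hsq n) rfl hnt)
  obtain ⟨hLω, hΩω⟩ := hcca (p n) (G n) (Lbar n) (Ωbar n) _ (t n) (hband n) (hΩ n) (hspec n)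
    (hL n) (hratio n) (Real.sqrt_nonneg _) hnε fun a b => (hω a b).le
  have hrate_n : t n * √(p n)
      ≤ √κ * √((((G n).edgeSet.ncard : ℝ) + 1) * Real.log (p n) / n) := by
    rw [mul_div_assoc]
    exact sqrt_mul_mul_sqrt_le hκ (by positivity) (by exact_mod_cast hcard n)
  rw [Set.mem_ofPred_eq, mul_assoc, mul_assoc]
  exact ⟨hLω.trans (by gcongr), hΩω.trans (by gcongr)⟩

theorem lemma7
    (p : ℕ → ℕ) (hp3 : ∀ n, 3 ≤ p n) (hp : Tendsto p atTop atTop)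
    -- the `p`-cycle with an RCM ordering
    (σ : ∀ n, Fin (p n) ≃ Fin (p n))
    (hσ : ∀ n, IsRCMOrdering (SimpleGraph.cycleGraph (p n)) (σ n))
    (Gσ : ∀ n, SimpleGraph (Fin (p n)))
    (hGσ : ∀ n, Gσ n = orderedGraph (SimpleGraph.cycleGraph (p n)) (σ n))
    -- the true precision matrices and their Cholesky factors
    (Ωbar Lbar : ∀ n, Matrix (Fin (p n)) (Fin (p n)) ℝ)
    (hΩ : ∀ n, Ωbar n ∈ concentrationSet (Gσ n))
    (hL : ∀ n, IsCholeskyFactor (Lbar n) (Ωbar n))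
    -- the observations
    {X : ℕ → Type*} [∀ n, MeasurableSpace (X n)]
    (P : ∀ n, Measure (X n)) [∀ n, IsProbabilityMeasure (P n)]
    (Y : ∀ n, Fin n → X n → Fin (p n) → ℝ)
    (hY : ∀ n, IsIIDSample (P n) (Y n) (Ωbar n))
    -- A1
    (hA1 : ∃ δ : ℝ, 0 < δ ∧ ∀ n, ∀ t ∈ spectrum ℝ (Ωbar n), δ ≤ t ∧ t ≤ δ⁻¹)
    -- A2
    (hA2 : ∃ c : ℝ, 0 < c ∧ ∀ n (i : Fin n) (x : Fin (p n) → ℝ),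
      Integrable (fun ω => Real.exp (x ⬝ᵥ Y n i ω)) (P n) ∧
      ∫ ω, Real.exp (x ⬝ᵥ Y n i ω) ∂(P n) ≤ Real.exp (c * (x ⬝ᵥ x)))
    -- A3', first part (rows `3 ≤ j ≤ p - 1`, which are `2 ≤ j ≤ p - 2` when counted from `0`)
    (hA3ratio : ∃ ξ : ℝ, ξ < 1 ∧ ∀ n (i j : Fin (p n)), (i : ℕ) + 2 = j → (j : ℕ) + 1 < p n →
      |Lbar n j i| / Lbar n j j ≤ ξ)
    -- A3', second part
    (hA3rate : Tendsto (fun n : ℕ => ((Gσ n).edgeSet.ncard : ℝ) * Real.log (p n) / n)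
      atTop (𝓝 0)) :
    ∃ K K' : ℝ,
      Tendsto (fun n : ℕ => P n {ω |
          ‖ccaL (Gσ n) (sampleCov fun i => Y n i ω) - Lbar n‖
            ≤ K * √((((Gσ n).edgeSet.ncard : ℝ) + 1) * Real.log (p n) / n) ∧
          ‖ccaOmega (Gσ n) (sampleCov fun i => Y n i ω) - Ωbar n‖
            ≤ K' * √((((Gσ n).edgeSet.ncard : ℝ) + 1) * Real.log (p n) / n)})
        atTop (𝓝 1) := by
  have hcard : ∀ n, p n ≤ (Gσ n).edgeSet.ncard + 1 := fun n =>
    hGσ n ▸ le_ncard_edgeSet_orderedGraph (connected_cycleGraph (by linarith [hp3 n])) (σ n)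
  exact lemma7_general p hp Gσ
    (fun n => hGσ n ▸ (hσ n).hasBandwidthLE_two ncard_neighborSet_cycleGraph_le) hcard
    Ωbar Lbar hΩ hL P Y (fun n => (hY n).measurable) (fun n => (hY n).indep)
    (fun n => (hY n).cov) hA1 hA2 hA3ratio
    (tendsto_log_div_of_tendsto_mul_log_div
      (Eventually.of_forall fun n => by linarith [hp3 n, hcard n]) hA3rate)
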